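/- Let $L,T,\sigma>0$, $\theta\in\{1,-1\}$, $\mathcal Z=\mathbb Z^2\setminus\{0\}$, and for $k\in\mathcal Z$ let $\mu_k=(2\pi|k|/L)^2$ and $e_k(x)=\omega_{k_1}(x_1)\,\omega_{k_2}(x_2)$, where $\omega_m(z)=\sqrt{2/L}\,\sin(2\pi m z/L)$ for $m>0$, $\omega_0=1/\sqrt L$, and $\omega_m(z)=\sqrt{2/L}\,\cos(2\pi m z/L)$ for $m<0$. For $s\in\mathbb R$ let $\mathcal H^s$ be the space of (formal) series $\sum_{k\in\mathcal Z}c_ke_k$ with $\sum_k\mu_k^s c_k^2<\infty$, normed by the square root of this sum, and let $e^{-t\Delta^2}\sum_k c_ke_k=\sum_k e^{-t\mu_k^2}c_ke_k$. Let $f(z)=z/(1+|z|^2)$ for $z\in\mathbb R^2$. Let $(\beta_k)_{k\in\mathcal Z}$ be independent standard real Brownian motions on a probability space, and let real numbers $\alpha_k^{(\varepsilon)}$ ($k\in\mathcal Z$, $\varepsilon>0$) satisfy: they are uniformly bounded in $k$ and $\varepsilon$; for each $\varepsilon>0$ there is $\delta(\varepsilon)>0$ with $\alpha_k^{(\varepsilon)}=\mathcal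 O(|k|^{-\delta(\varepsilon)})$; $\alpha_k^{(\varepsilon)}\to1$ as $\varepsilon\to0$ for each $k$; and $\alpha_k^{(\varepsilon)}$ depends on $k$ only through $|k|$. Put $$Z_\varepsilon(t)=\sum_{k\in\mathcal Z}\alpha_k^{(\varepsilon)}\int_0^te^{-(t-s)\mu_k^2}\,d\beta_k(s)\;e_k .$$ Let $u_0\in\mathcal H^1$ (deterministic), and for every $\varepsilon>0$ let $u_\varepsilon$ be the mild solution, i.e. a process with (almost surely) continuous paths in $\mathcal H^1$ on $[0,T]$ such that almost surely, for all $t\in[0,T]$, $$u_\varepsilon(t)=e^{-t\Delta^2}u_0+\theta\int_0^te^{-(t-s)\Delta^2}\,\nabla\cdot f(\nabla u_\varepsilon(s))\,ds+\sigma Z_\varepsilon(t).$$ Then for every $\varepsilon>0$ and $t\in(0,T]$ the function $u_\varepsilon(t,\cdot)$ is almost surely (the Fourier series of) a continuously differentiable, $L$-periodic, mean-zero function on $\mathbb R^2$, so that $\nabla u_\varepsilon(t,x)$ is defined for every $x$; and for every $p>1$ and every $t\in(0,T]$, $$\sup_{x\in[0,L]^2}\mathbb E\big[\,|f(\nabla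 u_\varepsilon(t,x))|^p\,\big]\longrightarrow0\qquad(\varepsilon\to0).$$ -/

import Mathlib

open MeasureTheory ProbabilityTheory Filter Set
open scoped Topology NNReal ENNReal

noncomputable section

namespace ThinFilm

/-- The Euclidean plane. -/
abbrev Plane : Type := EuclideanSpace ℝ (Fin 2)

/-- The square `[0,L]²`. -/
def square (L : ℝ) : Set Plane := {x | ∀ i, x i ∈ Icc 0 L}

/-- Nonzero Fourier modes, i.e. the elements of `ℤ² \ {0}`. -/
abbrev Mode : Type := {k : ℤ × ℤ // k ≠ 0}

/-- The Euclidean length `|k|` of a mode. -/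
def modeNorm (k : Mode) : ℝ := √((k.1.1 : ℝ) ^ 2 + (k.1.2 : ℝ) ^ 2)

/-- The eigenvalue `μ_k = (2 π |k| / L)²` of `-Δ`; the eigenvalues of `Δ²` are `μ_k²`. -/
def eigenvalue (L : ℝ) (k : Mode) : ℝ := (2 * Real.pi * modeNorm k / L) ^ 2

/-- The one-dimensional real trigonometric orthonormal basis of `L²([0,L])`. -/
def trig (L : ℝ) (m : ℤ) (z : ℝ) : ℝ :=
  if 0 < m then √(2 / L) * Real.sin (2 * Real.pi * m / L * z)
  else if m = 0 then 1 / √L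
  else √(2 / L) * Real.cos (2 * Real.pi * m / L * z)

/-- The orthonormal eigenfunction `e_k(x) = ω_{k₁}(x₁) ω_{k₂}(x₂)`. -/
def mode (L : ℝ) (k : Mode) (x : Plane) : ℝ := trig L k.1.1 (x 0) * trig L k.1.2 (x 1)

/-! ### Sobolev spaces of mean-zero periodic functions

An element `∑_{k ≠ 0} c_k e_k` of `H^s` is given by its family of Fourier coefficients. -/

/-- Membership of `∑ c_k e_k` in `H^s`: `∑ μ_k^s c_k² < ∞`. -/
def MemSobolev (L s : ℝ) (c : Mode → ℝ) : Prop :=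
  Summable fun k => eigenvalue L k ^ s * c k ^ 2

/-- The norm `(∑ μ_k^s c_k²)^{1/2}` of `H^s`. -/
def sobolevNorm (L s : ℝ) (c : Mode → ℝ) : ℝ := √(∑' k, eigenvalue L k ^ s * c k ^ 2)

/-- The path `c` takes values in `H^s` at the times in `S` and is norm continuous there. -/
def ContinuousOnSobolev (L s : ℝ) (c : ℝ → Mode → ℝ) (S : Set ℝ) : Prop :=
  (∀ t ∈ S, MemSobolev L s (c t)) ∧
    ∀ t ∈ S, Tendsto (fun r => sobolevNorm L s (c r - c t)) (𝓝[S] t) (𝓝 0)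

theorem isCompact_square (L : ℝ) : IsCompact (square L) := by
  have h : IsCompact (Set.univ.pi fun _ : Fin 2 => Icc (0 : ℝ) L) :=
    isCompact_univ_pi fun _ => isCompact_Icc
  have h2 := (EuclideanSpace.equiv (Fin 2) ℝ).toHomeomorph.isCompact_preimage.2 h
  convert h2 using 1
  ext x
  simp only [square, mem_ofPred_eq, mem_preimage, Set.mem_univ_pi]
  rfl

theorem contDiff_trig (L : ℝ) (m : ℤ) : ContDiff ℝ 1 (trig L m) := by
  unfold trig
  split_ifs <;> fun_prop

theorem contDiff_mode (L : ℝ) (k : Mode) : ContDiff ℝ 1 (mode L k) := by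
  have h (m : ℤ) (i : Fin 2) : ContDiff ℝ 1 fun x : Plane => trig L m (x i) :=
    (contDiff_trig L m).comp (by fun_prop)
  exact (h _ 0).mul (h _ 1)

theorem continuous_gradient_mode (L : ℝ) (k : Mode) : Continuous (gradient (mode L k)) :=
  (InnerProductSpace.toDual ℝ Plane).symm.continuous.comp
    ((contDiff_mode L k).continuous_fderiv (by norm_num))

theorem memLp_gradient_mode (L : ℝ) (k : Mode) :
    MemLp (gradient (mode L k)) 2 (volume.restrict (square L)) := by
  have : IsFiniteMeasure (volume.restrict (square L)) :=
    ⟨by simpa using (isCompact_square L).measure_lt_top⟩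
  obtain ⟨C, hC⟩ := (isCompact_square L).exists_bound_of_continuousOn
    (continuous_gradient_mode L k).continuousOn
  exact MemLp.of_bound (continuous_gradient_mode L k).aestronglyMeasurable C
    ((ae_restrict_iff' (isCompact_square L).measurableSet).2 (ae_of_all _ hC))

/-- The gradient `∑ c_k ∇e_k` of `∑ c_k e_k`, as a series in `L²([0,L]²; ℝ²)`. The summands are
orthogonal with squared norms `μ_k c_k²`, so the series converges for every element of `H¹`. -/
def gradL2 (L : ℝ) (c : Mode → ℝ) : Lp Plane 2 (volume.restrict (square L)) :=
  ∑' k, c k • (memLp_gradient_mode L k).toLp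

/-- The nonlinearity `f(z) = z / (1 + |z|²)` on `ℝ²`. -/
def nonlin (z : Plane) : Plane := (1 + ‖z‖ ^ 2)⁻¹ • z

/-- The `k`-th Fourier coefficient of the distribution `∇ · f(∇ u) ∈ H⁻¹`, `u = ∑ c_k e_k`:
the divergence is tested against `e_k`, so that the coefficient is `-∫ f(∇u) · ∇e_k`. -/
def driftCoeff (L : ℝ) (c : Mode → ℝ) (k : Mode) : ℝ :=
  -∫ x in square L, inner ℝ (nonlin (gradL2 L c x)) (gradient (mode L k) x)

/-! ### Noise -/

/-- The coefficients `β_k` of a cylindrical Wiener process `∑ β_k e_k`: independent standard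
Brownian motions. -/
structure IsCylindricalWiener {Ω : Type*} [MeasurableSpace Ω] (β : Mode → ℝ≥0 → Ω → ℝ)
    (P : Measure Ω) : Prop where
  brownian : ∀ k, IsBrownianReal (β k) P
  indep : iIndepFun (fun k ω t => β k t ω) P

/-- The pathwise integral `∫_0^t g dβ` of a continuously differentiable function `g` against a
continuous path `b`, that is `g(t) b(t) - g(0) b(0) - ∫_0^t g'(s) b(s) ds`.
It is the limit of the left-point sums of the Itô integral, see `tendsto_leftSum`. -/
def pathIntegral (g b : ℝ → ℝ) (t : ℝ) : ℝ :=
  g t * b t - g 0 * b 0 - ∫ s in (0 : ℝ)..t, deriv g s * b s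

theorem tendsto_leftSum (g b : ℝ → ℝ) (hg : ContDiff ℝ 1 g) (hb : Continuous b) {t : ℝ}
    (ht : 0 ≤ t) :
    Tendsto (fun n : ℕ => ∑ i ∈ Finset.range n,
      g (t * i / n) * (b (t * (i + 1 : ℕ) / n) - b (t * i / n))) atTop
      (𝓝 (pathIntegral g b t)) := by
  have hg' : Continuous (deriv g) := hg.continuous_deriv (by norm_num)
  have hgd (x : ℝ) : HasDerivAt g (deriv g x) x := (hg.differentiable (by norm_num) x).hasDerivAt
  obtain ⟨M, hM⟩ := (isCompact_Icc (a := (0 : ℝ)) (b := t)).exists_bound_of_continuousOn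
    hg'.continuousOn
  have hM0 : 0 ≤ M := (norm_nonneg _).trans (hM 0 ⟨le_rfl, ht⟩)
  have huc := (isCompact_Icc (a := (0 : ℝ)) (b := t)).uniformContinuousOn_of_continuous
    hb.continuousOn
  rw [Metric.uniformContinuousOn_iff] at huc
  rw [Metric.tendsto_atTop]
  intro e he
  obtain ⟨δ, hδ, hbδ⟩ := huc (e / (M * t + 1)) (by positivity)
  obtain ⟨N, hN⟩ := exists_nat_gt (t / δ)
  refine ⟨N + 1, fun n hn => ?_⟩
  have hn0 : (0 : ℝ) < n := by exact_mod_cast (by omega : 0 < n)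
  have htn : t / n < δ := by
    have : (N : ℝ) ≤ n := by exact_mod_cast (by omega : N ≤ n)
    rw [div_lt_iff₀ hδ] at hN
    rw [div_lt_iff₀ hn0]
    nlinarith
  set s : ℕ → ℝ := fun i => t * i / n with hs
  have hs0 : s 0 = 0 := by simp [hs]
  have hsn : s n = t := by simp [hs, hn0.ne']
  have hstep (i : ℕ) : s (i + 1) - s i = t / n := by simp only [hs]; push_cast; ring
  have hmono (i : ℕ) : s i ≤ s (i + 1) := by
    have := hstep i
    have : 0 ≤ t / n := by positivity
    linarith
  have hs_nonneg (i : ℕ) : 0 ≤ s i := by simp only [hs]; positivity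
  have hs_le (i : ℕ) (hi : i < n) : s (i + 1) ≤ t := by
    have : ((i + 1 : ℕ) : ℝ) ≤ n := by exact_mod_cast hi
    simp only [hs]
    rw [div_le_iff₀ hn0]
    gcongr
  have hint (c d : ℝ) : IntervalIntegrable (fun r => deriv g r * b r) volume c d :=
    (hg'.mul hb).intervalIntegrable _ _
  have hsum : ∑ i ∈ Finset.range n, ∫ r in s i..s (i + 1), deriv g r * b r
      = ∫ r in (0 : ℝ)..t, deriv g r * b r := by
    rw [intervalIntegral.sum_integral_adjacent_intervals (fun k _ => hint _ _), hs0, hsn]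
  have htel : ∑ i ∈ Finset.range n, (g (s (i + 1)) * b (s (i + 1)) - g (s i) * b (s i))
      = g t * b t - g 0 * b 0 := by
    rw [Finset.sum_range_sub (fun i => g (s i) * b (s i)), hs0, hsn]
  have hdiff : (∑ i ∈ Finset.range n, g (s i) * (b (s (i + 1)) - b (s i))) - pathIntegral g b t
      = ∑ i ∈ Finset.range n,
        ∫ r in s i..s (i + 1), deriv g r * (b r - b (s (i + 1))) := by
    rw [pathIntegral, ← htel, ← hsum, ← Finset.sum_sub_distrib, ← Finset.sum_sub_distrib]
    refine Finset.sum_congr rfl fun i _ => ?_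
    have h1 : ∫ r in s i..s (i + 1), deriv g r = g (s (i + 1)) - g (s i) :=
      intervalIntegral.integral_eq_sub_of_hasDerivAt (fun x _ => hgd x)
        (hg'.intervalIntegrable _ _)
    simp only [mul_sub]
    rw [intervalIntegral.integral_sub (hint _ _)
      ((hg'.intervalIntegrable _ _).mul_const _), intervalIntegral.integral_mul_const, h1]
    ring
  have hbd (i : ℕ) (hi : i ∈ Finset.range n) :
      ‖∫ r in s i..s (i + 1), deriv g r * (b r - b (s (i + 1)))‖
        ≤ M * (e / (M * t + 1)) * (t / n) := by
    have hi' := hs_le i (Finset.mem_range.1 hi)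
    have := intervalIntegral.norm_integral_le_of_norm_le_const (a := s i) (b := s (i + 1))
      (f := fun r => deriv g r * (b r - b (s (i + 1)))) (C := M * (e / (M * t + 1))) ?_
    · rwa [hstep, abs_of_nonneg (by positivity)] at this
    intro r hr
    rw [uIoc_of_le (hmono i)] at hr
    have hr0 : r ∈ Icc 0 t := ⟨(hs_nonneg i).trans hr.1.le, hr.2.trans hi'⟩
    rw [norm_mul]
    refine mul_le_mul (hM r hr0) ?_ (norm_nonneg _) hM0
    refine (hbδ r hr0 _ ⟨hs_nonneg _, hi'⟩ ?_).le
    rw [Real.dist_eq, abs_lt]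
    have := hstep i
    exact ⟨by linarith [hr.1], by linarith [hr.2]⟩
  change dist (∑ i ∈ Finset.range n, g (s i) * (b (s (i + 1)) - b (s i))) _ < e
  rw [dist_eq_norm, hdiff]
  calc _ ≤ ∑ i ∈ Finset.range n, M * (e / (M * t + 1)) * (t / n) := norm_sum_le_of_le _ hbd
    _ = e * ((M * t) / (M * t + 1)) := by
      rw [Finset.sum_const, Finset.card_range, nsmul_eq_mul]
      field_simp
    _ < e * 1 := by
      gcongr
      rw [div_lt_one (by positivity)]
      linarith
    _ = e := mul_one e

/-- The coefficient `Z_k(t) = ∫_0^t exp(-(t-s) μ_k²) dβ_k(s)` of the stochastic convolution. -/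
def convCoeff {Ω : Type*} (L : ℝ) (β : Mode → ℝ≥0 → Ω → ℝ) (t : ℝ) (ω : Ω) (k : Mode) : ℝ :=
  pathIntegral (fun s => Real.exp (-(t - s) * eigenvalue L k ^ 2))
    (fun s => β k s.toNNReal ω) t

/-- Admissible regularizations `α ε k = α_k^{(ε)}` of the noise, for `ε > 0`. -/
structure IsRegularization (α : ℝ → Mode → ℝ) : Prop where
  bounded : ∃ M : ℝ, ∀ ε > 0, ∀ k, |α ε k| ≤ M
  decay : ∀ ε > 0, ∃ δ : ℝ, 0 < δ ∧ ∃ C : ℝ, ∀ k, |α ε k| ≤ C * modeNorm k ^ (-δ)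
  tendsto_one : ∀ k, Tendsto (fun ε => α ε k) (𝓝[>] 0) (𝓝 1)
  radial : ∀ ε > 0, ∀ k l, modeNorm k = modeNorm l → α ε k = α ε l

/-- `u` is a mild solution on `[0,T]`, with continuous paths in `H¹`, of
`∂ₜ u = -Δ² u + θ ∇ · f(∇u) + σ ∂ₜ W_a`, `u(0) = u₀`, where `W_a = ∑ a_k β_k e_k`. That is,
`u(t) = e^{-tΔ²} u₀ + θ ∫_0^t e^{-(t-s)Δ²} ∇ · f(∇u(s)) ds + σ ∑ a_k Z_k(t) e_k` for all `t`,
written out for the Fourier coefficients. -/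
structure IsMildSolution {Ω : Type*} [MeasurableSpace Ω] (P : Measure Ω) (L T σ θ : ℝ)
    (β : Mode → ℝ≥0 → Ω → ℝ) (a u₀ : Mode → ℝ) (u : ℝ → Ω → Mode → ℝ) : Prop where
  aemeasurable : ∀ t ∈ Icc 0 T, ∀ k, AEMeasurable (fun ω => u t ω k) P
  continuous : ∀ᵐ ω ∂P, ContinuousOnSobolev L 1 (fun t => u t ω) (Icc 0 T)
  mild : ∀ᵐ ω ∂P, ∀ t ∈ Icc 0 T, ∀ k,
    u t ω k = Real.exp (-t * eigenvalue L k ^ 2) * u₀ k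
      + θ * (∫ s in (0 : ℝ)..t, Real.exp (-(t - s) * eigenvalue L k ^ 2) * driftCoeff L (u s ω) k)
      + σ * (a k * convCoeff L β t ω k)

/-- `φ` is the (unique) continuously differentiable, `L`-periodic, mean-zero function whose Fourier
series is `∑ c_k e_k`. -/
structure IsC1Version (L : ℝ) (c : Mode → ℝ) (φ : Plane → ℝ) : Prop where
  contDiff : ContDiff ℝ 1 φ
  periodic : ∀ x i, φ (x + EuclideanSpace.single i L) = φ x
  mean_zero : ∫ x in square L, φ x = 0
  coeff : ∀ k, ∫ x in square L, φ x * mode L k x = c k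

end ThinFilm

end

/-! Write `u(t) = A + σ Z_ε(t)`, where `A` collects the semigroup and Duhamel terms. The argument is
that `A` has a gradient bounded by a deterministic constant independent of `ε`, while the gradient
of the noise is a centred Gaussian whose variance blows up. A Gaussian of huge variance rarely lies
in a fixed bounded interval, and off that event `|∇u|` is large, so `|f(∇u)| ≤ 1/|∇u|` is small. The
bound on `A` is pathwise, so nothing about the joint law of drift and noise is needed.

Bound on `A`: since `|f| ≤ 1`, Bessel's inequality for the orthogonal system `∇e_k` bounds `∇·f(∇u)`
in `H⁻¹` whatever `u` is (`exists_sum_driftCoeff_sq_le`). The smoothing of `e^{-(t-s)Δ²}` costs only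
an integrable singularity in time, and `∑ √μ_k |A_k| ≤ K` follows (`exists_sum_duhamel_le`,
`exists_sum_semigroup_le`, `exists_decomposition`).

Blow-up of the variance: the variance of `∂₁Z_ε(t,x)` is comparable to `∑ α_k² (∂₁e_k(x))² / μ_k²`,
which for `α = 1` behaves like `∑ |k|⁻²` and diverges logarithmically in dimension two. Finitely
many modes already give any prescribed variance, and on these `α_k^{(ε)} → 1`. Summing over the
signs of `k₁`, `k₂` removes the dependence on `x`, hence uniformity in `x` (`exists_shellVar_ge`).

Regularity for fixed `ε`: the decay `|k|^{-δ}` with small `δ` does not make `∑ √μ_k |Z_k|` finite,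
so the gradient series is grouped into dyadic shells. High Gaussian moments on a fine grid, with a
Lipschitz bound between grid points, give normal convergence of the shell sums
(`ae_shellSummable_noise`). -/

noncomputable section

namespace ThinFilm

/-! ### The trigonometric basis -/

/-- The frequency `2 π m / L`. -/
def freq (L : ℝ) (m : ℤ) : ℝ := 2 * Real.pi * m / L

theorem freq_neg (L : ℝ) (m : ℤ) : freq L (-m) = -freq L m := by
  simp [freq, neg_div]

/-- Sine for `m > 0` and cosine for `m < 0` make differentiation the index change `m ↦ -m` times the
signed frequency, with no case distinction; all later derivative computations rest on this. -/
theorem hasDerivAt_trig (L : ℝ) (m : ℤ) (z : ℝ) :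
    HasDerivAt (trig L m) (freq L m * trig L (-m) z) z := by
  have hlin : HasDerivAt (fun y : ℝ => 2 * Real.pi * m / L * y) (2 * Real.pi * m / L) z := by
    simpa using (hasDerivAt_id z).const_mul (2 * Real.pi * m / L)
  rcases lt_trichotomy m 0 with h | h | h
  · have e : trig L m = fun y => √(2 / L) * Real.cos (2 * Real.pi * m / L * y) := by
      funext y; simp [trig, h.not_gt, h.ne]
    rw [e]
    convert! (hlin.cos.const_mul √(2 / L)) using 1
    simp only [trig, freq, Left.neg_pos_iff, h, if_true, Int.cast_neg, mul_neg, neg_div, neg_mul,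
      Real.sin_neg]
    ring
  · subst h
    have e : trig L 0 = fun _ => 1 / √L := by funext y; simp [trig]
    rw [e]
    simpa [freq] using hasDerivAt_const z (1 / √L)
  · have e : trig L m = fun y => √(2 / L) * Real.sin (2 * Real.pi * m / L * y) := by
      funext y; simp [trig, h]
    rw [e]
    convert! (hlin.sin.const_mul √(2 / L)) using 1
    have h1 : ¬ (0 < -m) := by omega
    have h2 : ¬ (-m = 0) := by omega
    simp only [trig, freq, h1, h2, if_false, Int.cast_neg, mul_neg, neg_div, neg_mul,
      Real.cos_neg]
    ring

theorem continuous_trig (L : ℝ) (m : ℤ) : Continuous (trig L m) := (contDiff_trig L m).continuous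

theorem trig_add_period {L : ℝ} (hL : 0 < L) (m : ℤ) (z : ℝ) : trig L m (z + L) = trig L m z := by
  have e : 2 * Real.pi * m / L * (z + L) = 2 * Real.pi * m / L * z + m * (2 * Real.pi) := by
    field_simp
  simp only [trig, e, Real.sin_add_int_mul_two_pi, Real.cos_add_int_mul_two_pi]

theorem trig_sq_add_trig_neg_sq {L : ℝ} (hL : 0 < L) {m : ℤ} (hm : m ≠ 0) (z : ℝ) :
    trig L m z ^ 2 + trig L (-m) z ^ 2 = 2 / L := by
  wlog h : 0 < m generalizing m
  · have := this (m := -m) (by simpa) (by omega)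
    rwa [neg_neg, add_comm] at this
  have h1 : ¬ (0 < -m) := by omega
  have h2 : ¬ (-m = 0) := by omega
  simp only [trig, h, h1, h2, if_true, if_false, Int.cast_neg, mul_neg, neg_div, neg_mul,
      Real.cos_neg, mul_pow]
  rw [Real.sq_sqrt (by positivity), ← mul_add, Real.sin_sq_add_cos_sq, mul_one]

theorem abs_trig_le {L : ℝ} (hL : 0 < L) (m : ℤ) (z : ℝ) : |trig L m z| ≤ √(2 / L) := by
  rcases eq_or_ne m 0 with rfl | h
  · simp only [trig, lt_irrefl, if_false, if_true]
    rw [abs_of_nonneg (by positivity), ← Real.sqrt_one, ← Real.sqrt_div (by norm_num)]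
    gcongr
    norm_num
  · rw [← Real.sqrt_sq_eq_abs]
    apply Real.sqrt_le_sqrt
    rw [← trig_sq_add_trig_neg_sq hL h z]
    nlinarith [sq_nonneg (trig L (-m) z)]

/-- No product-to-sum formulas are needed: the derivative of `ω_m ω_n` has integral zero over a
period, which gives linear relations between the integrals with indices `±m`, `±n`. For `m = n ≠ 0`
these are completed by `ω_m² + ω_{-m}² = 2/L`. -/
theorem integral_trig_mul_trig {L : ℝ} (hL : 0 < L) (m n : ℤ) :
    ∫ z in (0 : ℝ)..L, trig L m z * trig L n z = if m = n then 1 else 0 := by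
  have per (m : ℤ) : trig L m L = trig L m 0 := by simpa using trig_add_period hL m 0
  have cont (m n : ℤ) : Continuous fun z => trig L m z * trig L n z :=
    (continuous_trig L m).mul (continuous_trig L n)
  have ii (m n : ℤ) : IntervalIntegrable (fun z => trig L m z * trig L n z) volume 0 L :=
    (cont m n).intervalIntegrable _ _
  have freq0 {m : ℤ} (hm : m ≠ 0) : freq L m ≠ 0 := by
    have := Real.pi_pos
    unfold freq; positivity
  -- the derivative of a product integrates to zero over a period
  have key (m n : ℤ) : freq L m * (∫ z in (0 : ℝ)..L, trig L (-m) z * trig L n z)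
      + freq L n * ∫ z in (0 : ℝ)..L, trig L m z * trig L (-n) z = 0 := by
    have h := intervalIntegral.integral_eq_sub_of_hasDerivAt (a := 0) (b := L)
      (f := fun z => trig L m z * trig L n z)
      (f' := fun z => freq L m * (trig L (-m) z * trig L n z)
        + freq L n * (trig L m z * trig L (-n) z))
      (fun x _ => by
        convert! (hasDerivAt_trig L m x).mul (hasDerivAt_trig L n x) using 1
        ring)
      ((((cont _ _).const_mul _).add ((cont _ _).const_mul _)).intervalIntegrable _ _)
    rw [intervalIntegral.integral_add ((ii _ _).const_mul _) ((ii _ _).const_mul _),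
      intervalIntegral.integral_const_mul, intervalIntegral.integral_const_mul, per, per,
      sub_self] at h
    exact h
  split_ifs with hmn
  · subst hmn
    rcases eq_or_ne m 0 with rfl | h
    · simp only [trig, lt_irrefl, if_false, if_true, intervalIntegral.integral_const, sub_zero,
        smul_eq_mul]
      rw [div_mul_div_comm, Real.mul_self_sqrt hL.le]
      field_simp
    · have h1 := key m (-m)
      rw [freq_neg, neg_neg] at h1
      have h2 : (∫ z in (0 : ℝ)..L, trig L m z * trig L m z)
          + ∫ z in (0 : ℝ)..L, trig L (-m) z * trig L (-m) z = 2 := by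
        rw [← intervalIntegral.integral_add (ii _ _) (ii _ _)]
        have : ∀ z, trig L m z * trig L m z + trig L (-m) z * trig L (-m) z = 2 / L := fun z => by
          rw [← trig_sq_add_trig_neg_sq hL h z]; ring
        simp only [this, intervalIntegral.integral_const, sub_zero, smul_eq_mul]
        field_simp
      have h3 : (∫ z in (0 : ℝ)..L, trig L (-m) z * trig L (-m) z)
          = ∫ z in (0 : ℝ)..L, trig L m z * trig L m z :=
        mul_left_cancel₀ (freq0 h) (by linarith)
      linarith
  · by_cases hneg : m = -n
    · subst hneg
      have hn : n ≠ 0 := fun h => hmn (by simp [h])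
      have h1 := key n n
      simp only [mul_comm (trig L n _)] at h1
      have := freq0 hn
      have h4 : freq L n * ∫ z in (0 : ℝ)..L, trig L (-n) z * trig L n z = 0 := by linarith
      exact (mul_eq_zero.1 h4).resolve_left this
    · have h1 := key (-m) n
      have h2 := key m (-n)
      rw [freq_neg, neg_neg] at h1 h2
      have hsq : freq L n ^ 2 - freq L m ^ 2 ≠ 0 := by
        intro h0
        have : freq L n = freq L m ∨ freq L n = -freq L m := sq_eq_sq_iff_eq_or_eq_neg.1 (by linarith)
        have hc : 2 * Real.pi / L ≠ 0 := by
          have := Real.pi_pos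
          positivity
        have e (m : ℤ) : freq L m = 2 * Real.pi / L * m := by simp [freq]; ring
        rw [e, e, ← mul_neg] at this
        rcases this with h | h
        · have := mul_left_cancel₀ hc h
          exact hmn (by exact_mod_cast this.symm)
        · have : n = -m := by exact_mod_cast mul_left_cancel₀ hc h
          omega
      -- The two relations couple the integrals for `(m, n)` and `(-m, -n)`; eliminating the latter
      -- leaves this nonzero determinant times the former.
      refine (mul_eq_zero.1 (?_ : (freq L n ^ 2 - freq L m ^ 2) * _ = 0)).resolve_left hsq
      linear_combination freq L m * h1 - freq L n * h2

/-! ### The modes -/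

theorem setIntegral_square_mul {L : ℝ} (hL : 0 < L) (g h : ℝ → ℝ) :
    ∫ x in square L, g (x 0) * h (x 1) = (∫ z in (0 : ℝ)..L, g z) * ∫ z in (0 : ℝ)..L, h z := by
  have hm := (isCompact_square L).measurableSet
  rw [intervalIntegral.integral_of_le hL.le, intervalIntegral.integral_of_le hL.le,
    ← integral_Icc_eq_integral_Ioc, ← integral_Icc_eq_integral_Ioc,
    ← integral_indicator hm, ← integral_indicator measurableSet_Icc,
    ← integral_indicator measurableSet_Icc]
  have h1 := integral_fintype_prod_volume_eq_prod (𝕜 := ℝ) (ι := Fin 2) (E := fun _ => ℝ)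
    (fun i => (Icc 0 L).indicator (![g, h] i))
  simp only [Fin.prod_univ_two, Matrix.cons_val_zero, Matrix.cons_val_one] at h1
  rw [← h1, ← (EuclideanSpace.volume_preserving_symm_measurableEquiv_toLp
    (Fin 2)).integral_comp (MeasurableEquiv.measurableEmbedding _)]
  congr 1
  funext x
  simp only [indicator, square, Fin.forall_fin_two, mem_ofPred_eq]
  by_cases h0 : x 0 ∈ Icc 0 L <;> by_cases h1 : x 1 ∈ Icc 0 L <;>
    simp [h0, h1]

theorem continuous_mode (L : ℝ) (k : Mode) : Continuous (mode L k) := (contDiff_mode L k).continuous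

theorem integral_mode_mul_mode {L : ℝ} (hL : 0 < L) (k l : Mode) :
    ∫ x in square L, mode L k x * mode L l x = if k = l then 1 else 0 := by
  have : ∀ x : Plane, mode L k x * mode L l x
      = (trig L k.1.1 (x 0) * trig L l.1.1 (x 0)) * (trig L k.1.2 (x 1) * trig L l.1.2 (x 1)) :=
    fun x => by simp only [mode]; ring
  simp only [this]
  rw [setIntegral_square_mul hL (fun z => trig L k.1.1 z * trig L l.1.1 z)
    (fun z => trig L k.1.2 z * trig L l.1.2 z), integral_trig_mul_trig hL,
    integral_trig_mul_trig hL]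
  have : k = l ↔ k.1.1 = l.1.1 ∧ k.1.2 = l.1.2 := by
    rw [← Subtype.coe_inj, Prod.ext_iff]
  simp only [this]
  split_ifs <;> simp_all

/-- This is orthogonality to the constant function, handled separately because the index `(0, 0)` is
excluded from `Mode`. -/
theorem integral_mode {L : ℝ} (hL : 0 < L) (k : Mode) : ∫ x in square L, mode L k x = 0 := by
  have hc : ∀ z, trig L 0 z = 1 / √L := fun z => by simp [trig]
  have h := setIntegral_square_mul hL (fun z => trig L k.1.1 z * trig L 0 z)
    (fun z => trig L k.1.2 z * trig L 0 z)
  rw [integral_trig_mul_trig hL, integral_trig_mul_trig hL] at h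
  have e : ∀ x : Plane, trig L k.1.1 (x 0) * trig L 0 (x 0) * (trig L k.1.2 (x 1) * trig L 0 (x 1))
      = (1 / √L * (1 / √L)) * mode L k x := fun x => by simp only [hc, mode]; ring
  simp only [e] at h
  rw [integral_const_mul] at h
  have hk : ¬ (k.1.1 = 0 ∧ k.1.2 = 0) := fun h => k.2 (Prod.ext h.1 h.2)
  have h0 : (1 / √L * (1 / √L)) ≠ 0 := by positivity
  refine (mul_eq_zero.1 (h.trans ?_)).resolve_left h0
  split_ifs <;> simp_all

theorem abs_mode_le {L : ℝ} (hL : 0 < L) (k : Mode) (x : Plane) : |mode L k x| ≤ 2 / L := by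
  rw [mode, abs_mul]
  calc _ ≤ √(2 / L) * √(2 / L) :=
        mul_le_mul (abs_trig_le hL _ _) (abs_trig_le hL _ _) (abs_nonneg _) (by positivity)
    _ = 2 / L := Real.mul_self_sqrt (by positivity)

/-- The `i`-th component of a mode. -/
def comp (k : Mode) (i : Fin 2) : ℤ := if i = 0 then k.1.1 else k.1.2

/-- The mode with the `i`-th component negated. -/
def reflect (i : Fin 2) (k : Mode) : Mode :=
  ⟨if i = 0 then (-k.1.1, k.1.2) else (k.1.1, -k.1.2), by
    have := k.2
    split_ifs <;> simpa [Prod.ext_iff] using this⟩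

theorem reflect_injective (i : Fin 2) : Function.Injective (reflect i) := by
  intro k l h
  have := congrArg Subtype.val h
  apply Subtype.ext
  fin_cases i <;> simpa [reflect, Prod.ext_iff] using this

/-- The `i`-th partial derivative of the `k`-th mode. -/
def dmode (L : ℝ) (i : Fin 2) (k : Mode) (x : Plane) : ℝ :=
  freq L (comp k i) * mode L (reflect i k) x

theorem hasFDerivAt_mode (L : ℝ) (k : Mode) (x : Plane) :
    HasFDerivAt (mode L k) (∑ i, dmode L i k x • (EuclideanSpace.proj i : Plane →L[ℝ] ℝ)) x := by
  have h (m : ℤ) (i : Fin 2) : HasFDerivAt (fun x : Plane => trig L m (x i))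
      ((freq L m * trig L (-m) (x i)) • (EuclideanSpace.proj i : Plane →L[ℝ] ℝ)) x := by
    have h1 : HasFDerivAt (fun x : Plane => x i) (EuclideanSpace.proj i : Plane →L[ℝ] ℝ) x :=
      (EuclideanSpace.proj i : Plane →L[ℝ] ℝ).hasFDerivAt
    exact (hasDerivAt_trig L m (x i)).comp_hasFDerivAt x h1
  convert! (h k.1.1 0).mul (h k.1.2 1) using 1
  rw [Fin.sum_univ_two, add_comm]
  simp only [dmode, mode, comp, reflect, smul_smul]
  simp
  congr 2 <;> ring

theorem fderiv_mode (L : ℝ) (k : Mode) (x : Plane) :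
    fderiv ℝ (mode L k) x = ∑ i, dmode L i k x • (EuclideanSpace.proj i : Plane →L[ℝ] ℝ) :=
  (hasFDerivAt_mode L k x).fderiv

theorem gradient_apply (f : Plane → ℝ) (x : Plane) (i : Fin 2) :
    gradient f x i = fderiv ℝ f x (EuclideanSpace.single i 1) := by
  rw [← InnerProductSpace.toDual_symm_apply (𝕜 := ℝ) (y := fderiv ℝ f x), EuclideanSpace.inner_single_right]
  simp [gradient]

theorem gradient_mode_apply (L : ℝ) (k : Mode) (x : Plane) (i : Fin 2) :
    gradient (mode L k) x i = dmode L i k x := by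
  rw [gradient_apply, fderiv_mode]
  fin_cases i <;> simp [Fin.sum_univ_two]

theorem eigenvalue_eq (L : ℝ) (k : Mode) : eigenvalue L k = ∑ i, freq L (comp k i) ^ 2 := by
  simp only [eigenvalue, modeNorm, freq, comp, Fin.sum_univ_two]
  rw [div_pow, mul_pow, Real.sq_sqrt (by positivity)]
  simp
  ring

theorem continuous_dmode (L : ℝ) (i : Fin 2) (k : Mode) : Continuous (dmode L i k) :=
  (continuous_mode L _).const_mul _

theorem integrableOn_square {E : Type*} [NormedAddCommGroup E] {L : ℝ} {f : Plane → E}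
    (hf : Continuous f) :
    IntegrableOn f (square L) := hf.continuousOn.integrableOn_compact (isCompact_square L)

/-- Each partial derivative sends `e_k` to a multiple of the reflected mode. Reflection is
injective, so orthonormality of the modes passes to each component of the gradient. -/
theorem integral_inner_gradient_mode {L : ℝ} (hL : 0 < L) (k l : Mode) :
    ∫ x in square L, inner ℝ (gradient (mode L k) x) (gradient (mode L l) x)
      = if k = l then eigenvalue L k else 0 := by
  have e : ∀ x, inner ℝ (gradient (mode L k) x) (gradient (mode L l) x)
      = ∑ i, freq L (comp k i) * freq L (comp l i) *
        (mode L (reflect i k) x * mode L (reflect i l) x) := fun x => by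
    simp only [PiLp.inner_apply, gradient_mode_apply, dmode]
    exact Finset.sum_congr rfl fun i _ => by simp; ring
  simp only [e]
  have hi : ∀ i ∈ Finset.univ, IntegrableOn (fun x => freq L (comp k i) * freq L (comp l i) *
      (mode L (reflect i k) x * mode L (reflect i l) x)) (square L) := fun i _ =>
    (integrableOn_square ((continuous_mode L _).mul (continuous_mode L _))).const_mul _
  rw [integral_finsetSum _ hi]
  simp only [integral_const_mul, integral_mode_mul_mode hL, (reflect_injective _).eq_iff]
  split_ifs with h
  · subst h
    simp only [eigenvalue_eq, mul_one, sq]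
  · simp

/-! ### Summability over the modes -/

/-- The larger of `|k₁|` and `|k₂|`. -/
def supNorm (k : Mode) : ℕ := max k.1.1.natAbs k.1.2.natAbs

theorem one_le_supNorm (k : Mode) : 1 ≤ supNorm k := by
  by_contra! h
  have : k.1.1.natAbs = 0 ∧ k.1.2.natAbs = 0 := by unfold supNorm at h; omega
  exact k.2 (Prod.ext (Int.natAbs_eq_zero.1 this.1) (Int.natAbs_eq_zero.1 this.2))

theorem supNorm_le_modeNorm (k : Mode) : (supNorm k : ℝ) ≤ modeNorm k := by
  rw [supNorm, Nat.cast_max, Nat.cast_natAbs, Nat.cast_natAbs, Int.cast_abs, Int.cast_abs]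
  refine max_le ?_ ?_ <;> rw [← Real.sqrt_sq_eq_abs] <;> apply Real.sqrt_le_sqrt <;>
    nlinarith [sq_nonneg (k.1.1 : ℝ), sq_nonneg (k.1.2 : ℝ)]

theorem modeNorm_le_supNorm (k : Mode) : modeNorm k ≤ 2 * supNorm k := by
  rw [modeNorm, Real.sqrt_le_left (by positivity)]
  have h1 : (k.1.1 : ℝ) ^ 2 ≤ (supNorm k : ℝ) ^ 2 := by
    rw [← sq_abs, ← Int.cast_abs, ← Nat.cast_natAbs]
    gcongr
    exact le_max_left _ _
  have h2 : (k.1.2 : ℝ) ^ 2 ≤ (supNorm k : ℝ) ^ 2 := by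
    rw [← sq_abs, ← Int.cast_abs, ← Nat.cast_natAbs]
    gcongr
    exact le_max_right _ _
  nlinarith [sq_nonneg (supNorm k : ℝ)]

theorem one_le_modeNorm (k : Mode) : 1 ≤ modeNorm k :=
  le_trans (by exact_mod_cast one_le_supNorm k) (supNorm_le_modeNorm k)

theorem modeNorm_pos (k : Mode) : 0 < modeNorm k := one_pos.trans_le (one_le_modeNorm k)

theorem eigenvalue_pos {L : ℝ} (hL : 0 < L) (k : Mode) : 0 < eigenvalue L k := by
  have := modeNorm_pos k
  have := Real.pi_pos
  unfold eigenvalue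
  positivity

theorem eigenvalue_eq_mul_modeNorm_sq (L : ℝ) (k : Mode) :
    eigenvalue L k = (2 * Real.pi / L) ^ 2 * modeNorm k ^ 2 := by
  rw [eigenvalue, ← mul_pow]
  ring

theorem modeNorm_rpow_neg_two_add (k : Mode) (δ : ℝ) :
    modeNorm k ^ (-(2 + δ)) = (modeNorm k ^ 2)⁻¹ * modeNorm k ^ (-δ) := by
  have hm := modeNorm_pos k
  rw [neg_add, Real.rpow_add hm, Real.rpow_neg hm.le, Real.rpow_two]

theorem sqrt_eigenvalue {L : ℝ} (hL : 0 < L) (k : Mode) :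
    √(eigenvalue L k) = 2 * Real.pi / L * modeNorm k := by
  have := modeNorm_pos k
  have := Real.pi_pos
  rw [eigenvalue, Real.sqrt_sq (by positivity)]
  ring

theorem summable_modeNorm_rpow {a : ℝ} (ha : 2 < a) : Summable fun k : Mode => modeNorm k ^ (-a) := by
  let φ : Mode → Fin 2 → ℤ := fun k => ![k.1.1, k.1.2]
  have hφ : Function.Injective φ := fun k l h =>
    Subtype.ext (Prod.ext (by simpa [φ] using congrFun h 0) (by simpa [φ] using congrFun h 1))
  -- Comparison with the lattice sum for the maximum norm, known from Eisenstein series.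
  refine ((EisensteinSeries.summable_one_div_norm_rpow ha).comp_injective hφ).of_nonneg_of_le
    (fun k => by have := modeNorm_pos k; positivity) fun k => ?_
  have e : ‖φ k‖ = supNorm k := by
    simp [φ, EisensteinSeries.norm_eq_max_natAbs, supNorm]
  have h1 : (0 : ℝ) < supNorm k := by exact_mod_cast one_le_supNorm k
  simp only [Function.comp, e]
  exact Real.rpow_le_rpow_of_nonpos h1 (supNorm_le_modeNorm k) (by linarith)

theorem summable_eigenvalue_rpow {L a : ℝ} (hL : 0 < L) (ha : 1 < a) :
    Summable fun k => eigenvalue L k ^ (-a) := by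
  refine ((summable_modeNorm_rpow (a := 2 * a) (by linarith)).mul_left
    ((2 * Real.pi / L) ^ (-(2 * a)))).congr fun k => ?_
  have := modeNorm_pos k
  have := Real.pi_pos
  rw [← Real.mul_rpow (by positivity) (by positivity), ← sqrt_eigenvalue hL,
    Real.sqrt_eq_rpow, ← Real.rpow_mul (eigenvalue_pos hL k).le]
  congr 1
  ring

/-! ### The drift -/

theorem norm_nonlin (z : Plane) : ‖nonlin z‖ = ‖z‖ / (1 + ‖z‖ ^ 2) := by
  rw [nonlin, norm_smul, norm_inv, Real.norm_of_nonneg (by positivity), inv_mul_eq_div]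

theorem norm_nonlin_le_one (z : Plane) : ‖nonlin z‖ ≤ 1 := by
  rw [norm_nonlin, div_le_one (by positivity)]
  nlinarith [sq_nonneg (‖z‖ - 1)]

theorem continuous_nonlin : Continuous nonlin := by
  unfold nonlin
  refine (Continuous.inv₀ (continuous_const.add (continuous_norm.pow 2)) fun z => ?_).smul continuous_id
  exact (by positivity : (0 : ℝ) < 1 + ‖z‖ ^ 2).ne'

/-- Bessel's inequality for the orthonormal family `∇e_k / √μ_k` applied to the field `f(∇u)`, which
is bounded by `1`. The constant is the area of the square, so it depends neither on `c` nor on the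
convergence of its gradient series. -/
theorem exists_sum_driftCoeff_sq_le {L : ℝ} (hL : 0 < L) : ∃ C : ℝ,
    ∀ (c : Mode → ℝ) (F : Finset Mode), ∑ k ∈ F, driftCoeff L c k ^ 2 / eigenvalue L k ≤ C := by
  set ν : Measure Plane := volume.restrict (square L) with hν
  have : IsFiniteMeasure ν := ⟨by simpa [hν] using (isCompact_square L).measure_lt_top⟩
  refine ⟨(ν.real univ ^ (2 : ℝ≥0∞).toReal⁻¹ * 1) ^ 2, fun c F => ?_⟩
  have hmeas : AEStronglyMeasurable (fun x => nonlin (gradL2 L c x)) ν :=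
    continuous_nonlin.comp_aestronglyMeasurable (Lp.aestronglyMeasurable _)
  have hmem : MemLp (fun x => nonlin (gradL2 L c x)) 2 ν :=
    MemLp.of_bound hmeas 1 (ae_of_all _ fun x => norm_nonlin_le_one _)
  set G : Mode → Lp Plane 2 ν := fun k => (memLp_gradient_mode L k).toLp with hG
  have hinner (k l : Mode) : inner ℝ (G k) (G l) = if k = l then eigenvalue L k else 0 := by
    rw [← integral_inner_gradient_mode hL, L2.inner_def]
    refine integral_congr_ae ?_
    filter_upwards [(memLp_gradient_mode L k).coeFn_toLp, (memLp_gradient_mode L l).coeFn_toLp]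
      with x h1 h2
    rw [h1, h2]
  have hdrift (k : Mode) : driftCoeff L c k = -inner ℝ (G k) hmem.toLp := by
    rw [driftCoeff, L2.inner_def]
    congr 1
    refine integral_congr_ae ?_
    filter_upwards [(memLp_gradient_mode L k).coeFn_toLp, hmem.coeFn_toLp] with x h1 h2
    rw [h1, h2, real_inner_comm]
  have hon : Orthonormal ℝ fun k => (√(eigenvalue L k))⁻¹ • G k := by
    rw [orthonormal_iff_ite]
    intro k l
    rw [real_inner_smul_left, real_inner_smul_right, hinner]
    split_ifs with h
    · subst h
      have := eigenvalue_pos hL k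
      rw [← mul_assoc, ← mul_inv, Real.mul_self_sqrt this.le, inv_mul_cancel₀ this.ne']
    · simp
  calc ∑ k ∈ F, driftCoeff L c k ^ 2 / eigenvalue L k
      = ∑ k ∈ F, ‖inner ℝ ((√(eigenvalue L k))⁻¹ • G k) hmem.toLp‖ ^ 2 := by
        refine Finset.sum_congr rfl fun k _ => ?_
        rw [real_inner_smul_left, hdrift, neg_sq, Real.norm_eq_abs, sq_abs, mul_pow, inv_pow,
          Real.sq_sqrt (eigenvalue_pos hL k).le]
        field_simp
    _ ≤ ‖hmem.toLp‖ ^ 2 := hon.sum_inner_products_le _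
    _ ≤ _ := by
        gcongr
        refine Lp.norm_le_of_ae_bound zero_le_one ?_
        filter_upwards [hmem.coeFn_toLp] with x hx
        rw [hx]
        exact norm_nonlin_le_one _

/-- With `y = τ x²` this says `y^a e^{-2y} ≤ 1` for `a = 7/4`. The power `x^{2-2a}` is summable over
the eigenvalues when `a > 3/2`, and `τ^{-a/2}` is integrable at `0` when `a < 2`; `7/4` is the
midpoint. -/
theorem sq_mul_exp_le {x τ : ℝ} (hx : 0 < x) (hτ : 0 < τ) :
    x ^ 2 * Real.exp (-τ * x ^ 2) ^ 2 ≤ x ^ (-(3 / 2) : ℝ) * τ ^ (-(7 / 4) : ℝ) := by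
  set y := τ * x ^ 2 with hy
  have hy0 : 0 < y := by positivity
  have h1 : y ^ (7 / 4 : ℝ) ≤ 1 + y ^ 2 := by
    rcases le_total y 1 with h | h
    · exact (Real.rpow_le_one hy0.le h (by norm_num)).trans (by nlinarith)
    · calc y ^ (7 / 4 : ℝ) ≤ y ^ (2 : ℝ) := Real.rpow_le_rpow_of_exponent_le h (by norm_num)
        _ = y ^ 2 := Real.rpow_two y
        _ ≤ _ := by linarith
  have h2 : Real.exp (-τ * x ^ 2) ^ 2 = (Real.exp (2 * y))⁻¹ := by
    rw [← Real.exp_nat_mul, ← Real.exp_neg]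
    congr 1
    push_cast
    ring
  have h3 : 1 + y ^ 2 ≤ Real.exp (2 * y) := by
    have := Real.quadratic_le_exp_of_nonneg (x := 2 * y) (by positivity)
    nlinarith
  have h4 : x ^ 2 = x ^ (-(3 / 2) : ℝ) * τ ^ (-(7 / 4) : ℝ) * y ^ (7 / 4 : ℝ) := by
    rw [hy, Real.mul_rpow hτ.le (by positivity), ← Real.rpow_two, ← Real.rpow_mul hx.le]
    rw [show x ^ (-(3 / 2) : ℝ) * τ ^ (-(7 / 4) : ℝ) * (τ ^ (7 / 4 : ℝ) * x ^ (2 * (7 / 4) : ℝ))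
      = (x ^ (-(3 / 2) : ℝ) * x ^ (2 * (7 / 4) : ℝ)) * (τ ^ (-(7 / 4) : ℝ) * τ ^ (7 / 4 : ℝ)) by ring,
      ← Real.rpow_add hx, ← Real.rpow_add hτ]
    norm_num
  rw [h2, h4, mul_assoc]
  refine mul_le_of_le_one_right (by positivity) ?_
  rw [← div_eq_mul_inv, div_le_one (Real.exp_pos _)]
  exact h1.trans h3

/-- Factor the left side as `(x e^{-τx²}) (|d|/√x)` and use `ab ≤ a² + b²` with the first factor
weighted by `τ^{7/8}`. The result separates a summable part from the `H⁻¹` norm of `d`. -/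
theorem sqrt_mul_exp_mul_abs_le {x τ : ℝ} (hx : 0 < x) (hτ : 0 < τ) (d : ℝ) :
    √x * (Real.exp (-τ * x ^ 2) * |d|) ≤ τ ^ (-(7 / 8) : ℝ) * (x ^ (-(3 / 2) : ℝ) + d ^ 2 / x) := by
  set e := Real.exp (-τ * x ^ 2) with he
  have hw : 0 < τ ^ (7 / 8 : ℝ) := by positivity
  have hwi : τ ^ (-(7 / 8) : ℝ) = (τ ^ (7 / 8 : ℝ))⁻¹ := Real.rpow_neg hτ.le _
  have hw2 : τ ^ (-(7 / 4) : ℝ) = ((τ ^ (7 / 8 : ℝ))⁻¹) ^ 2 := by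
    rw [← hwi, ← Real.rpow_natCast, ← Real.rpow_mul hτ.le]
    norm_num
  have h1 := sq_mul_exp_le hx hτ
  rw [hw2, ← he] at h1
  clear_value e
  rw [hwi]
  set w := τ ^ (7 / 8 : ℝ)
  set S := x ^ (-(3 / 2) : ℝ)
  have hS : 0 ≤ S := by positivity
  have hs : √x ^ 2 = x := Real.sq_sqrt hx.le
  have hsp : 0 < √x := by positivity
  set s := √x
  rw [← hs] at h1 ⊢
  have h2 : (s ^ 2) ^ 2 * e ^ 2 * w ^ 2 ≤ S := by
    calc _ ≤ (S * (w⁻¹) ^ 2) * w ^ 2 := by gcongr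
      _ = S := by field_simp
  rw [← sq_abs d, inv_mul_eq_div, le_div_iff₀ hw]
  have h3 : s * (e * |d|) * w = (s ^ 2 * e * w) * (|d| / s) := by field_simp
  have h4 : |d| ^ 2 / s ^ 2 = (|d| / s) ^ 2 := by rw [div_pow]
  rw [h3, h4]
  nlinarith [sq_nonneg (s ^ 2 * e * w - |d| / s), sq_nonneg (s ^ 2 * e * w + |d| / s)]

/-- Superadditivity of the lower integral holds without measurability, so the drift coefficients
need not be shown measurable in time. -/
theorem sum_lintegral_le_lintegral_sum {X ι : Type*} [MeasurableSpace X] (ν : Measure X) (F : Finset ι)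
    (f : ι → X → ℝ≥0∞) : ∑ i ∈ F, ∫⁻ x, f i x ∂ν ≤ ∫⁻ x, ∑ i ∈ F, f i x ∂ν := by
  classical
  induction F using Finset.induction_on with
  | empty => simp
  | insert i F hi ih =>
    simp only [Finset.sum_insert hi]
    exact (by gcongr : _ ≤ _).trans (le_lintegral_add _ _)

/-- Bounding the sum over `k` before integrating in time leaves the kernel `(t-s)^{-7/8}`. The path
`d` is arbitrary: a non-integrable integrand has Bochner integral zero, and passing to lower
integrals keeps every estimate valid. -/
theorem exists_sum_duhamel_le {L t C : ℝ} (hL : 0 < L) (ht : 0 < t) :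
    ∃ K : ℝ, ∀ d : ℝ → Mode → ℝ,
    (∀ s, ∀ F : Finset Mode, ∑ k ∈ F, d s k ^ 2 / eigenvalue L k ≤ C) → ∀ F : Finset Mode,
      ∑ k ∈ F, √(eigenvalue L k) *
        |∫ s in (0 : ℝ)..t, Real.exp (-(t - s) * eigenvalue L k ^ 2) * d s k| ≤ K := by
  have hsum := summable_eigenvalue_rpow hL (a := 3 / 2) (by norm_num)
  set S := ∑' k, eigenvalue L k ^ (-(3 / 2) : ℝ) with hS
  have hS0 : 0 ≤ S := tsum_nonneg fun k => by have := eigenvalue_pos hL k; positivity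
  set w : ℝ → ℝ := fun s => (t - s) ^ (-(7 / 8) : ℝ) * (S + C) with hw
  have hwi : IntegrableOn w (Ioc 0 t) := by
    rw [← intervalIntegrable_iff_integrableOn_Ioc_of_le ht.le]
    have h := (intervalIntegral.intervalIntegrable_rpow' (a := 0) (b := t) (r := -(7 / 8))
      (by norm_num)).comp_sub_left t
    simpa using (h.symm.mul_const (S + C))
  have hwl : ∫⁻ s in Ioc 0 t, ENNReal.ofReal (w s) < ∞ := hwi.lintegral_lt_top
  refine ⟨(∫⁻ s in Ioc 0 t, ENNReal.ofReal (w s)).toReal, fun d hd F => ?_⟩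
  rw [← ENNReal.ofReal_le_iff_le_toReal hwl.ne, ENNReal.ofReal_sum_of_nonneg
    (fun k _ => by positivity)]
  have hlt : ∀ᵐ s ∂(volume.restrict (Ioc 0 t)), s < t := by
    have h0 : ∀ᵐ s ∂(volume.restrict (Ioc 0 t)), s ≠ t :=
      ae_restrict_of_ae (Measure.ae_ne volume t)
    filter_upwards [h0, ae_restrict_mem measurableSet_Ioc] with s h1 h2
    exact lt_of_le_of_ne h2.2 h1
  calc _ ≤ ∑ k ∈ F, ∫⁻ s in Ioc 0 t, ENNReal.ofReal
        (√(eigenvalue L k) * (Real.exp (-(t - s) * eigenvalue L k ^ 2) * |d s k|)) := by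
        refine Finset.sum_le_sum fun k _ => ?_
        rw [← abs_of_nonneg (Real.sqrt_nonneg (eigenvalue L k)), ← abs_mul,
          ← intervalIntegral.integral_const_mul, intervalIntegral.integral_of_le ht.le,
          ← Real.norm_eq_abs, ← Real.norm_eq_abs, ofReal_norm]
        refine (enorm_integral_le_lintegral_enorm _).trans_eq ?_
        refine lintegral_congr fun s => ?_
        rw [← ofReal_norm, norm_mul, norm_mul, Real.norm_of_nonneg (Real.exp_pos _).le,
          Real.norm_eq_abs (d s k)]
    _ ≤ ∫⁻ s in Ioc 0 t, ∑ k ∈ F, ENNReal.ofReal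
        (√(eigenvalue L k) * (Real.exp (-(t - s) * eigenvalue L k ^ 2) * |d s k|)) :=
        sum_lintegral_le_lintegral_sum _ _ _
    _ ≤ ∫⁻ s in Ioc 0 t, ENNReal.ofReal (w s) := by
        refine lintegral_mono_ae ?_
        filter_upwards [hlt] with s hs
        rw [← ENNReal.ofReal_sum_of_nonneg (fun k _ => by positivity)]
        refine ENNReal.ofReal_le_ofReal ?_
        calc _ ≤ ∑ k ∈ F, (t - s) ^ (-(7 / 8) : ℝ) *
              (eigenvalue L k ^ (-(3 / 2) : ℝ) + d s k ^ 2 / eigenvalue L k) :=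
              Finset.sum_le_sum fun k _ =>
                sqrt_mul_exp_mul_abs_le (eigenvalue_pos hL k) (sub_pos.2 hs) _
          _ ≤ w s := by
              rw [← Finset.mul_sum, Finset.sum_add_distrib, hw]
              have := sub_pos.2 hs
              refine mul_le_mul_of_nonneg_left (add_le_add ?_ (hd s F)) (by positivity)
              exact hsum.sum_le_tsum F fun k _ => by have := eigenvalue_pos hL k; positivity

theorem exists_sum_semigroup_le {L t : ℝ} (hL : 0 < L) (ht : 0 < t) {u₀ : Mode → ℝ}
    (hu₀ : MemSobolev L 1 u₀) : ∃ K : ℝ, ∀ F : Finset Mode,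
      ∑ k ∈ F, √(eigenvalue L k) * |Real.exp (-t * eigenvalue L k ^ 2) * u₀ k| ≤ K := by
  have hsum := summable_eigenvalue_rpow hL (a := 2) (by norm_num)
  simp only [MemSobolev, Real.rpow_one] at hu₀
  have hb (k : Mode) : √(eigenvalue L k) * |Real.exp (-t * eigenvalue L k ^ 2) * u₀ k|
      ≤ t⁻¹ * eigenvalue L k ^ (-2 : ℝ) + eigenvalue L k * u₀ k ^ 2 := by
    have hp := eigenvalue_pos hL k
    set x := eigenvalue L k
    set y := t * x ^ 2 with hy
    have hy0 : 0 < y := by positivity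
    have h1 : Real.exp (-t * x ^ 2) ≤ 1 := Real.exp_le_one_iff.2 (by nlinarith)
    have h2 : Real.exp (-t * x ^ 2) ≤ t⁻¹ * x ^ (-2 : ℝ) := by
      have : t⁻¹ * x ^ (-2 : ℝ) = y⁻¹ := by
        rw [Real.rpow_neg hp.le, Real.rpow_two, hy, mul_inv]
      rw [this, show -t * x ^ 2 = -y by rw [hy]; ring, Real.exp_neg]
      gcongr
      linarith [Real.add_one_le_exp y]
    have h3 : √x ^ 2 = x := Real.sq_sqrt hp.le
    rw [abs_mul, abs_of_pos (Real.exp_pos _), ← h3, ← sq_abs (u₀ k)]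
    rw [h3]
    have h0 := Real.exp_pos (-t * x ^ 2)
    have h5 : x * |u₀ k| ^ 2 = (√x * |u₀ k|) ^ 2 := by rw [mul_pow, h3]
    rw [h5]
    set e := Real.exp (-t * x ^ 2)
    have h6 : e ^ 2 ≤ e := by nlinarith
    -- Young's inequality for `e · (√x |u₀ k|)`; then `e² ≤ e ≤ t⁻¹ x⁻²`.
    nlinarith [sq_nonneg (e - √x * |u₀ k|), sq_nonneg (e + √x * |u₀ k|)]
  have hs := (hsum.mul_left t⁻¹).add hu₀
  refine ⟨_, fun F => (Finset.sum_le_sum fun k _ => hb k).trans (hs.sum_le_tsum F fun k _ => ?_)⟩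
  have hp := eigenvalue_pos hL k
  positivity

/-! ### Gaussian sums -/

theorem hasLaw_gaussianReal_sum {Ω ι : Type*} [MeasurableSpace Ω] {P : Measure Ω}
    [IsProbabilityMeasure P] {X : ι → Ω → ℝ} {v : ι → ℝ≥0} (hX : ∀ i, HasLaw (X i) (gaussianReal 0 (v i)) P)
    (hind : iIndepFun X P) (F : Finset ι) (c : ι → ℝ) :
    HasLaw (fun ω => ∑ i ∈ F, c i * X i ω)
      (gaussianReal 0 (∑ i ∈ F, Real.toNNReal (c i ^ 2) * v i)) P := by
  classical
  have hX' (i : ι) : HasLaw (fun ω => c i * X i ω) (gaussianReal 0 (Real.toNNReal (c i ^ 2) * v i)) P := by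
    have h := gaussianReal_const_mul (hX i) (c i)
    rw [mul_zero] at h
    convert h using 3
    ext
    simp [Real.coe_toNNReal _ (sq_nonneg (c i))]
  have hind' : iIndepFun (fun i ω => c i * X i ω) P :=
    hind.comp (fun i x => c i * x) fun i => measurable_const_mul _
  induction F using Finset.induction_on with
  | empty =>
    simp only [Finset.sum_empty, gaussianReal_zero_var]
    exact ⟨aemeasurable_const, by simp⟩
  | insert i F hi ih =>
    have h1 := (hind'.indepFun_finsetSum_of_notMem₀ (fun j => (hX' j).aemeasurable) hi).symm
    have h2 : HasLaw (∑ j ∈ F, fun ω => c j * X j ω)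
        (gaussianReal 0 (∑ i ∈ F, Real.toNNReal (c i ^ 2) * v i)) P := by
      convert ih using 1
      funext ω
      simp
    have h3 := gaussianReal_add_gaussianReal_of_indepFun h1 (hX' i).map_eq h2.map_eq
    rw [add_zero] at h3
    have e : (fun ω => ∑ j ∈ insert i F, c j * X j ω)
        = (fun ω => c i * X i ω) + ∑ j ∈ F, fun ω => c j * X j ω := by
      funext ω
      simp [Finset.sum_insert hi]
    rw [e, Finset.sum_insert hi]
    exact ⟨(hX' i).aemeasurable.add h2.aemeasurable, h3⟩

/-- Characteristic functions converge along both descriptions of the sequence: by dominated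
convergence, and by the explicit Gaussian formula. -/
theorem hasLaw_gaussianReal_of_tendsto {Ω : Type*} [MeasurableSpace Ω] {P : Measure Ω}
    [IsProbabilityMeasure P] {X : ℕ → Ω → ℝ} {Y : Ω → ℝ} {v : ℕ → ℝ≥0} {w : ℝ≥0}
    (hX : ∀ n, HasLaw (X n) (gaussianReal 0 (v n)) P)
    (hv : Tendsto (fun n => (v n : ℝ)) atTop (𝓝 w))
    (hXY : ∀ᵐ ω ∂P, Tendsto (fun n => X n ω) atTop (𝓝 (Y ω))) :
    HasLaw Y (gaussianReal 0 w) P := by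
  have hY : AEMeasurable Y P := aemeasurable_of_tendsto_metrizable_ae atTop
    (fun n => (hX n).aemeasurable) hXY
  refine ⟨hY, ?_⟩
  have : IsProbabilityMeasure (P.map Y) := Measure.isProbabilityMeasure_map hY
  refine Measure.ext_of_charFun (funext fun ξ => ?_)
  have hchar {Z : Ω → ℝ} (hZ : AEMeasurable Z P) :
      charFun (P.map Z) ξ = ∫ ω, Complex.exp (ξ * Z ω * Complex.I) ∂P := by
    rw [charFun_apply_real, integral_map hZ (by fun_prop)]
  refine tendsto_nhds_unique (f := fun n => charFun (P.map (X n)) ξ) (l := atTop) ?_ ?_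
  · simp only [hchar hY, hchar (hX _).aemeasurable]
    refine tendsto_integral_of_dominated_convergence (fun _ => 1) (fun n => ?_)
      (integrable_const 1) (fun n => ae_of_all _ fun ω => ?_) ?_
    · have := (hX n).aemeasurable
      exact (by fun_prop : AEMeasurable _ P).aestronglyMeasurable
    · rw [← Complex.ofReal_mul, Complex.norm_exp_ofReal_mul_I]
    · filter_upwards [hXY] with ω hω
      have hc : Continuous fun y : ℝ => Complex.exp (ξ * y * Complex.I) := by fun_prop
      exact (hc.tendsto _).comp hω
  · simp only [(hX _).map_eq, charFun_gaussianReal]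
    have hc : Continuous fun y : ℝ =>
        Complex.exp (ξ * (0 : ℝ) * Complex.I - (y : ℂ) * ξ ^ 2 / 2) := by fun_prop
    exact (hc.tendsto _).comp hv

/-- The left-point sums of `∫_0^t g db` for a path `b` on the nonnegative half-line. -/
def leftSum (g : ℝ → ℝ) (t : ℝ) (n : ℕ) (b : ℝ≥0 → ℝ) : ℝ :=
  ∑ i ∈ Finset.range n, g (t * i / n) *
    (b (t * (i + 1 : ℕ) / n).toNNReal - b (t * i / n).toNNReal)

theorem measurable_leftSum (g : ℝ → ℝ) (t : ℝ) (n : ℕ) : Measurable (leftSum g t n) := by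
  unfold leftSum
  fun_prop

/-- The left-point Riemann sums of `∫_0^t g²`. -/
def leftVar (g : ℝ → ℝ) (t : ℝ) (n : ℕ) : ℝ≥0 :=
  ∑ i ∈ Finset.range n, Real.toNNReal (g (t * i / n) ^ 2) *
    ((t * (i + 1 : ℕ) / n).toNNReal - (t * i / n).toNNReal)

theorem hasLaw_leftSum {Ω : Type*} [MeasurableSpace Ω] {P : Measure Ω}
    [IsProbabilityMeasure P] {B : ℝ≥0 → Ω → ℝ} (hB : IsBrownianReal B P) (g : ℝ → ℝ) {t : ℝ}
    (ht : 0 ≤ t) (n : ℕ) :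
    HasLaw (fun ω => leftSum g t n fun s => B s ω) (gaussianReal 0 (leftVar g t n)) P := by
  have hmono : Monotone fun i : ℕ => (t * i / n).toNNReal := fun i j hij => by
    dsimp only
    gcongr
  have hind := hB.hasIndepIncrements.nat hmono
  refine hasLaw_gaussianReal_sum (X := fun i : ℕ => fun ω =>
    B (t * (i + 1 : ℕ) / n).toNNReal ω - B (t * i / n).toNNReal ω) (fun i => ?_) hind
    (Finset.range n) (fun i => g (t * i / n))
  have h := hB.hasLaw_sub (t * (i + 1 : ℕ) / n).toNNReal (t * i / n).toNNReal
  have h1 : (t * i / n).toNNReal ≤ (t * (i + 1 : ℕ) / n).toNNReal := hmono (Nat.le_succ i)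
  suffices e : nndist (t * (i + 1 : ℕ) / n).toNNReal.1 (t * i / n).toNNReal.1
      = (t * (i + 1 : ℕ) / n).toNNReal - (t * i / n).toNNReal by
    rw [e] at h
    exact h
  apply NNReal.coe_injective
  rw [NNReal.coe_sub h1, coe_nndist, Real.dist_eq, abs_of_nonneg]
  · rfl
  · exact sub_nonneg.2 (NNReal.coe_le_coe.2 h1)

/-- The variance of `∫_0^t exp(-(t-s) λ) dβ(s)`. -/
def convVar (t l : ℝ) : ℝ≥0 := Real.toNNReal ((1 - Real.exp (-(2 * l * t))) / (2 * l))

theorem tendsto_leftVar {t l : ℝ} (ht : 0 ≤ t) (hl : 0 < l) :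
    Tendsto (fun n => (leftVar (fun s => Real.exp (-(t - s) * l)) t n : ℝ)) atTop
      (𝓝 (convVar t l)) := by
  set g : ℝ → ℝ := fun s => Real.exp (-(t - s) * l) ^ 2 with hg
  have hgc : ContDiff ℝ 1 g := by fun_prop
  -- The Riemann sums of the variance are left-point sums against the path `b(s) = s`, so the
  -- convergence proved for the Itô sums applies; the limit is evaluated by parts.
  have h := tendsto_leftSum g id hgc continuous_id ht
  have hval : pathIntegral g id t = convVar t l := by
    have hd (s : ℝ) : HasDerivAt g (2 * l * g s) s := by
      have h1 : HasDerivAt (fun s => -(t - s) * l) l s := by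
        simpa using ((hasDerivAt_id s).const_sub t).neg.mul_const l
      convert! h1.exp.pow 2 using 1
      simp only [hg]
      ring
    have hparts : ∫ s in (0 : ℝ)..t, (deriv g s * s + g s) = g t * t - g 0 * 0 := by
      refine intervalIntegral.integral_eq_sub_of_hasDerivAt (f := fun s => g s * s) (fun s _ => ?_) ?_
      · convert! (hd s).mul (hasDerivAt_id s) using 1
        rw [(hd s).deriv]
        simp
      · exact (((hgc.continuous_deriv le_rfl).mul continuous_id).add hgc.continuous).intervalIntegrable _ _
    have hint : ∫ s in (0 : ℝ)..t, g s = (g t - g 0) / (2 * l) := by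
      have := intervalIntegral.integral_eq_sub_of_hasDerivAt (a := 0) (b := t) (f := g)
        (fun s _ => hd s) ((hgc.continuous.const_mul _).intervalIntegrable _ _)
      rw [intervalIntegral.integral_const_mul] at this
      rw [← this]
      field_simp
    have hi : IntervalIntegrable (fun s => deriv g s * s) volume 0 t :=
      ((hgc.continuous_deriv le_rfl).mul continuous_id).intervalIntegrable _ _
    rw [intervalIntegral.integral_add hi (hgc.continuous.intervalIntegrable _ _), hint] at hparts
    have hgt : g t = 1 := by simp [hg]
    have hg0 : g 0 = Real.exp (-(2 * l * t)) := by
      simp only [hg]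
      rw [← Real.exp_nat_mul]
      congr 1
      push_cast
      ring
    rw [convVar, Real.coe_toNNReal, ← hgt, ← hg0]
    · simp only [pathIntegral, id]
      linarith
    · have : Real.exp (-(2 * l * t)) ≤ 1 := Real.exp_le_one_iff.2 (by have := mul_nonneg hl.le ht; linarith)
      exact div_nonneg (by linarith) (by linarith)
  rw [hval] at h
  refine h.congr fun n => ?_
  simp only [leftVar, NNReal.coe_sum, NNReal.coe_mul]
  refine Finset.sum_congr rfl fun i _ => ?_
  have h0 : 0 ≤ t * i / n := by positivity
  have h1 : t * i / n ≤ t * (i + 1 : ℕ) / n := by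
    gcongr
    exact Nat.le_succ i
  rw [NNReal.coe_sub (Real.toNNReal_le_toNNReal h1), Real.coe_toNNReal _ h0,
    Real.coe_toNNReal _ (h0.trans h1), Real.coe_toNNReal _ (sq_nonneg _)]
  rfl

/-- Before the limit the left-point sums are independent Gaussians. They converge pathwise because
almost every Brownian path is continuous, and Gaussian laws survive the limit. -/
theorem hasLaw_sum_convCoeff {Ω : Type*} [MeasurableSpace Ω] {P : Measure Ω}
    [IsProbabilityMeasure P] {L t : ℝ} (hL : 0 < L) (ht : 0 ≤ t) {β : Mode → ℝ≥0 → Ω → ℝ}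
    (hβ : IsCylindricalWiener β P) (F : Finset Mode) (c : Mode → ℝ) :
    HasLaw (fun ω => ∑ k ∈ F, c k * convCoeff L β t ω k)
      (gaussianReal 0 (∑ k ∈ F, Real.toNNReal (c k ^ 2) * convVar t (eigenvalue L k ^ 2))) P := by
  set g : Mode → ℝ → ℝ := fun k s => Real.exp (-(t - s) * eigenvalue L k ^ 2) with hg
  refine hasLaw_gaussianReal_of_tendsto
    (X := fun n ω => ∑ k ∈ F, c k * leftSum (g k) t n fun s => β k s ω)
    (v := fun n => ∑ k ∈ F, Real.toNNReal (c k ^ 2) * leftVar (g k) t n) (fun n => ?_) ?_ ?_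
  · exact hasLaw_gaussianReal_sum (X := fun k ω => leftSum (g k) t n fun s => β k s ω)
      (fun k => hasLaw_leftSum (hβ.brownian k) _ ht n)
      (hβ.indep.comp _ fun k => measurable_leftSum _ _ _) F c
  · simp only [NNReal.coe_sum, NNReal.coe_mul]
    refine tendsto_finsetSum _ fun k _ => ?_
    exact (tendsto_leftVar ht (by have := eigenvalue_pos hL k; positivity)).const_mul _
  · filter_upwards [ae_all_iff.2 fun k => (hβ.brownian k).cont] with ω hω
    refine tendsto_finsetSum _ fun k _ => Tendsto.const_mul _ ?_
    exact tendsto_leftSum (g k) (fun s => β k s.toNNReal ω) (by simp only [hg]; fun_prop)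
      ((hω k).comp continuous_real_toNNReal) ht

theorem convVar_le {t l : ℝ} (hl : 0 < l) : (convVar t l : ℝ) ≤ 1 / (2 * l) := by
  rw [convVar, Real.coe_toNNReal']
  refine max_le ?_ (by positivity)
  gcongr
  linarith [Real.exp_pos (-(2 * l * t))]

theorem lintegral_enorm_pow_of_hasLaw {Ω : Type*} [MeasurableSpace Ω] {P : Measure Ω}
    {X : Ω → ℝ} {v : ℝ≥0} (hX : HasLaw X (gaussianReal 0 v) P) (n : ℕ) :
    ∫⁻ ω, ‖X ω‖ₑ ^ n ∂P = ‖√v‖ₑ ^ n * ∫⁻ x, ‖x‖ₑ ^ n ∂(gaussianReal 0 1) := by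
  have h1 : gaussianReal 0 v = (gaussianReal 0 1).map (√v * ·) := by
    rw [gaussianReal_map_const_mul, mul_zero]
    congr 1
    ext
    simp
  have hm : Measurable fun x : ℝ => ‖x‖ₑ ^ n := by fun_prop
  rw [← lintegral_map' hm.aemeasurable hX.aemeasurable, hX.map_eq, h1,
    lintegral_map hm (by fun_prop), ← lintegral_const_mul _ hm]
  simp only [enorm_mul, mul_pow]

theorem lintegral_enorm_pow_gaussianReal_lt_top (n : ℕ) :
    ∫⁻ x, ‖x‖ₑ ^ n ∂(gaussianReal 0 1) < ∞ := by
  rcases eq_or_ne n 0 with rfl | h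
  · simp
  · have h1 := (memLp_id_gaussianReal (μ := 0) (v := 1) n).eLpNorm_lt_top
    have h2 := lintegral_rpow_enorm_lt_top_of_eLpNorm_lt_top (by exact_mod_cast h) (by simp) h1
    simpa using h2

/-- The density is at most `1/√(2πv) ≤ 1/√v`. This is the source of anti-concentration. -/
theorem gaussianReal_Icc_le {v : ℝ≥0} (hv : v ≠ 0) (R : ℝ) :
    gaussianReal 0 v (Icc (-R) R) ≤ ENNReal.ofReal (2 * R / √v) := by
  rw [gaussianReal_apply 0 hv]
  have hv' : (0 : ℝ) < v := by positivity
  have hb (x : ℝ) : gaussianPDF 0 v x ≤ ENNReal.ofReal (1 / √v) := by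
    refine ENNReal.ofReal_le_ofReal ?_
    rw [gaussianPDFReal_def, one_div]
    have h1 : Real.exp (-(x - 0) ^ 2 / (2 * v)) ≤ 1 := Real.exp_le_one_iff.2
      (div_nonpos_of_nonpos_of_nonneg (by nlinarith [sq_nonneg (x - 0)]) (by positivity))
    have h2 : (√(2 * Real.pi * v))⁻¹ ≤ (√v)⁻¹ := by
      gcongr
      nlinarith [Real.pi_gt_three]
    calc _ ≤ (√v)⁻¹ * 1 := mul_le_mul h2 h1 (Real.exp_pos _).le (by positivity)
      _ = _ := mul_one _
  calc _ ≤ ∫⁻ _ in Icc (-R) R, ENNReal.ofReal (1 / √v) := lintegral_mono fun x => hb x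
    _ = ENNReal.ofReal (2 * R / √v) := by
      rw [setLIntegral_const, Real.volume_Icc, ← ENNReal.ofReal_mul (by positivity)]
      congr 1
      ring

/-! ### Summation over dyadic shells -/

/-- The dyadic level of a mode. -/
def level (k : Mode) : ℕ := Nat.log 2 (supNorm k)

theorem finite_level (j : ℕ) : {k : Mode | level k = j}.Finite := by
  have hfin : (Icc (-(2 ^ (j + 1) : ℤ)) (2 ^ (j + 1)) ×ˢ Icc (-(2 ^ (j + 1) : ℤ)) (2 ^ (j + 1))).Finite :=
    (finite_Icc _ _).prod (finite_Icc _ _)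
  refine (hfin.preimage Subtype.val_injective.injOn).subset fun k hk => ?_
  have h : supNorm k < 2 ^ (j + 1) := by
    rw [← (show level k = j from hk)]
    exact Nat.lt_pow_succ_log_self one_lt_two _
  have h1 : (k.1.1.natAbs : ℤ) ≤ 2 ^ (j + 1) := by
    exact_mod_cast (le_max_left _ _).trans h.le
  have h2 : (k.1.2.natAbs : ℤ) ≤ 2 ^ (j + 1) := by
    exact_mod_cast (le_max_right _ _).trans h.le
  rw [Int.natCast_natAbs, abs_le] at h1 h2
  exact ⟨h1, h2⟩

/-- The modes of level `j`. -/
def shell (j : ℕ) : Finset Mode := (finite_level j).toFinset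

theorem mem_shell {j : ℕ} {k : Mode} : k ∈ shell j ↔ level k = j := by
  simp [shell]

theorem two_pow_le_modeNorm {j : ℕ} {k : Mode} (hk : k ∈ shell j) : (2 : ℝ) ^ j ≤ modeNorm k := by
  refine le_trans ?_ (supNorm_le_modeNorm k)
  rw [← mem_shell.1 hk]
  exact_mod_cast Nat.pow_log_le_self 2 (Nat.one_le_iff_ne_zero.1 (one_le_supNorm k))

theorem modeNorm_le_two_pow {j : ℕ} {k : Mode} (hk : k ∈ shell j) : modeNorm k ≤ 4 * 2 ^ j := by
  refine (modeNorm_le_supNorm k).trans ?_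
  have : supNorm k < 2 ^ (j + 1) := by
    rw [← mem_shell.1 hk]
    exact Nat.lt_pow_succ_log_self one_lt_two _
  have h : (supNorm k : ℝ) ≤ 2 ^ (j + 1) := by exact_mod_cast this.le
  rw [pow_succ] at h
  linarith

/-- The modes of level less than `J`. -/
def box (J : ℕ) : Finset Mode := (Finset.range J).biUnion shell

theorem mem_box {J : ℕ} {k : Mode} : k ∈ box J ↔ level k < J := by
  simp [box, mem_shell]

theorem sum_box {E : Type*} [AddCommMonoid E] (f : Mode → E) (J : ℕ) :
    ∑ k ∈ box J, f k = ∑ j ∈ Finset.range J, ∑ k ∈ shell j, f k := by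
  refine Finset.sum_biUnion fun i _ j _ hij => Finset.disjoint_left.2 fun k hi hj => hij ?_
  rw [← mem_shell.1 hi, ← mem_shell.1 hj]

theorem summable_sum_shell {f : Mode → ℝ} {K : ℝ} (hf : ∀ k, 0 ≤ f k)
    (hK : ∀ F : Finset Mode, ∑ k ∈ F, f k ≤ K) : Summable fun j => ∑ k ∈ shell j, f k :=
  summable_of_sum_range_le (fun _ => Finset.sum_nonneg fun k _ => hf k)
    fun J => (sum_box f J).symm.trans_le (hK _)

theorem tsum_sum_shell_le {f : Mode → ℝ} {K : ℝ} (hf : ∀ k, 0 ≤ f k)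
    (hK : ∀ F : Finset Mode, ∑ k ∈ F, f k ≤ K) : ∑' j, ∑ k ∈ shell j, f k ≤ K :=
  Real.tsum_le_of_sum_range_le (fun _ => Finset.sum_nonneg fun k _ => hf k)
    fun J => (sum_box f J).symm.trans_le (hK _)

/-- The part `∑ c_k e_k` of a Fourier series over the `j`-th shell. -/
def shellSum (L : ℝ) (c : Mode → ℝ) (j : ℕ) (x : Plane) : ℝ := ∑ k ∈ shell j, c k * mode L k x

/-- The `i`-th partial derivative of `shellSum`. -/
def dshellSum (L : ℝ) (i : Fin 2) (c : Mode → ℝ) (j : ℕ) (x : Plane) : ℝ :=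
  ∑ k ∈ shell j, c k * dmode L i k x

theorem shellSum_add (L : ℝ) (c d : Mode → ℝ) (j : ℕ) (x : Plane) :
    shellSum L (c + d) j x = shellSum L c j x + shellSum L d j x := by
  simp [shellSum, add_mul, Finset.sum_add_distrib]

theorem dshellSum_add (L : ℝ) (i : Fin 2) (c d : Mode → ℝ) (j : ℕ) (x : Plane) :
    dshellSum L i (c + d) j x = dshellSum L i c j x + dshellSum L i d j x := by
  simp [dshellSum, add_mul, Finset.sum_add_distrib]

/-- The Fourier series `∑ c_k e_k`, summed shell by shell. -/
def series (L : ℝ) (c : Mode → ℝ) (x : Plane) : ℝ := ∑' j, shellSum L c j x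

/-- The shell sums of `∑ c_k e_k` and of its partial derivatives converge normally. -/
def ShellSummable (L : ℝ) (c : Mode → ℝ) : Prop :=
  ∃ b : ℕ → ℝ, Summable b ∧ ∀ j x, |shellSum L c j x| ≤ b j ∧ ∀ i, |dshellSum L i c j x| ≤ b j

theorem ShellSummable.add {L : ℝ} {c d : Mode → ℝ} (hc : ShellSummable L c)
    (hd : ShellSummable L d) : ShellSummable L (c + d) := by
  obtain ⟨b, hb, h⟩ := hc
  obtain ⟨b', hb', h'⟩ := hd
  refine ⟨b + b', hb.add hb', fun j x => ⟨?_, fun i => ?_⟩⟩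
  · rw [shellSum_add]
    exact (abs_add_le _ _).trans (add_le_add (h j x).1 (h' j x).1)
  · rw [dshellSum_add]
    exact (abs_add_le _ _).trans (add_le_add ((h j x).2 i) ((h' j x).2 i))

theorem ShellSummable.summable_dshellSum {L : ℝ} {c : Mode → ℝ} (hc : ShellSummable L c)
    (i : Fin 2) (x : Plane) : Summable fun j => dshellSum L i c j x := by
  obtain ⟨b, hb, h⟩ := hc
  exact hb.of_norm_bounded fun j => (h j x).2 i

theorem hasFDerivAt_shellSum (L : ℝ) (c : Mode → ℝ) (j : ℕ) (x : Plane) :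
    HasFDerivAt (shellSum L c j)
      (∑ i, dshellSum L i c j x • (EuclideanSpace.proj i : Plane →L[ℝ] ℝ)) x := by
  have h : HasFDerivAt (fun y => ∑ k ∈ shell j, c k * mode L k y)
      (∑ k ∈ shell j, c k • ∑ i, dmode L i k x • (EuclideanSpace.proj i : Plane →L[ℝ] ℝ)) x :=
    HasFDerivAt.fun_sum fun k _ => (hasFDerivAt_mode L k x).const_mul (c k)
  convert! h using 1
  simp only [dshellSum, Finset.smul_sum, Finset.sum_smul, smul_smul]
  exact Finset.sum_comm

theorem continuous_shellSum (L : ℝ) (c : Mode → ℝ) (j : ℕ) : Continuous (shellSum L c j) :=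
  continuous_finsetSum _ fun k _ => (continuous_mode L k).const_mul _

theorem continuous_dshellSum (L : ℝ) (i : Fin 2) (c : Mode → ℝ) (j : ℕ) :
    Continuous (dshellSum L i c j) :=
  continuous_finsetSum _ fun k _ => (continuous_dmode L i k).const_mul _

theorem ShellSummable.hasFDerivAt_series {L : ℝ} {c : Mode → ℝ} (hc : ShellSummable L c)
    (x : Plane) : HasFDerivAt (series L c)
      (∑ i, (∑' j, dshellSum L i c j x) • (EuclideanSpace.proj i : Plane →L[ℝ] ℝ)) x := by
  have hs := hc.summable_dshellSum
  obtain ⟨b, hb, h⟩ := hc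
  set M := ∑ i, ‖(EuclideanSpace.proj i : Plane →L[ℝ] ℝ)‖
  have h1 := hasFDerivAt_tsum (hb.mul_right M) (fun j y => hasFDerivAt_shellSum L c j y)
    (fun j y => by
      rw [Finset.mul_sum]
      refine norm_sum_le_of_le _ fun i _ => ?_
      rw [norm_smul]
      exact mul_le_mul_of_nonneg_right ((h j y).2 i) (norm_nonneg _))
    (x₀ := x) (hb.of_norm_bounded fun j => (h j x).1) x
  convert! h1 using 1
  have h2 (i : Fin 2) := (hs i x).hasSum.smul_const (EuclideanSpace.proj i : Plane →L[ℝ] ℝ)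
  exact (hasSum_sum fun i _ => h2 i).tsum_eq.symm

theorem ShellSummable.gradient_series {L : ℝ} {c : Mode → ℝ} (hc : ShellSummable L c)
    (x : Plane) (i : Fin 2) : gradient (series L c) x i = ∑' j, dshellSum L i c j x := by
  rw [gradient_apply, (hc.hasFDerivAt_series x).fderiv]
  fin_cases i <;> simp [Fin.sum_univ_two]

theorem ShellSummable.contDiff_series {L : ℝ} {c : Mode → ℝ} (hc : ShellSummable L c) :
    ContDiff ℝ 1 (series L c) := by
  refine contDiff_one_iff_hasFDerivAt.2 ⟨_, ?_, hc.hasFDerivAt_series⟩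
  obtain ⟨b, hb, h⟩ := hc
  refine continuous_finsetSum _ fun i _ => ?_
  have h1 : Continuous fun x => ∑' j, dshellSum L i c j x :=
    continuous_tsum (fun j => continuous_dshellSum L i c j) hb fun j x => (h j x).2 i
  exact h1.smul continuous_const

theorem mode_add_period {L : ℝ} (hL : 0 < L) (k : Mode) (x : Plane) (i : Fin 2) :
    mode L k (x + EuclideanSpace.single i L) = mode L k x := by
  fin_cases i <;> simp [mode, trig_add_period hL]

/-- Used with `φ = 1` for the mean and with `φ = e_k` for the Fourier coefficients. -/
theorem ShellSummable.hasSum_integral {L : ℝ} {c : Mode → ℝ} (hc : ShellSummable L c)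
    {φ : Plane → ℝ} (hφ : Continuous φ) {M : ℝ} (hM : ∀ x, |φ x| ≤ M) :
    HasSum (fun j => ∑ k ∈ shell j, c k * ∫ x in square L, mode L k x * φ x)
      (∫ x in square L, series L c x * φ x) := by
  obtain ⟨b, hb, h⟩ := hc
  have hfin : IsFiniteMeasure (volume.restrict (square L)) :=
    ⟨by simpa using (isCompact_square L).measure_lt_top⟩
  have h1 : HasSum (fun j => ∫ x in square L, shellSum L c j x * φ x)
      (∫ x in square L, series L c x * φ x) := by
    refine hasSum_integral_of_dominated_convergence (fun j _ => b j * M) (fun j => ?_) (fun j => ?_)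
      (ae_of_all _ fun _ => hb.mul_right M) (integrable_const _) (ae_of_all _ fun x => ?_)
    · exact ((continuous_shellSum L c j).mul hφ).aestronglyMeasurable
    · refine ae_of_all _ fun x => ?_
      rw [norm_mul]
      exact mul_le_mul (h j x).1 (hM x) (norm_nonneg _) ((abs_nonneg _).trans (h j x).1)
    · have h2 : HasSum (fun j => shellSum L c j x) (series L c x) :=
        Summable.hasSum (hb.of_norm_bounded fun j => (h j x).1)
      exact h2.mul_right (φ x)
  convert h1 using 2 with j
  have hi : ∀ k ∈ shell j, IntegrableOn (fun x => c k * (mode L k x * φ x)) (square L) :=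
    fun k _ => (integrableOn_square ((continuous_mode L k).mul hφ)).const_mul _
  simp only [shellSum, Finset.sum_mul, mul_assoc]
  rw [integral_finsetSum _ hi]
  simp only [integral_const_mul]

theorem ShellSummable.isC1Version_series {L : ℝ} (hL : 0 < L) {c : Mode → ℝ}
    (hc : ShellSummable L c) : IsC1Version L c (series L c) where
  contDiff := hc.contDiff_series
  periodic x i := by simp only [series, shellSum, mode_add_period hL]
  mean_zero := by
    have h := hc.hasSum_integral (φ := fun _ => 1) continuous_const (M := 1) (fun _ => by simp)
    simp only [mul_one, integral_mode hL, mul_zero, Finset.sum_const_zero] at h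
    exact h.unique hasSum_zero
  coeff k := by
    have h := hc.hasSum_integral (continuous_mode L k) (abs_mode_le hL k)
    simp only [integral_mode_mul_mode hL, mul_ite, mul_one, mul_zero, Finset.sum_ite_eq',
      mem_shell] at h
    refine h.unique ?_
    convert hasSum_ite_eq (level k) (c k) using 2 with j
    simp only [eq_comm]

theorem abs_freq_comp_le {L : ℝ} (k : Mode) (i : Fin 2) :
    |freq L (comp k i)| ≤ √(eigenvalue L k) := by
  rw [← Real.sqrt_sq_eq_abs, eigenvalue_eq]
  exact Real.sqrt_le_sqrt (Finset.single_le_sum (f := fun i => freq L (comp k i) ^ 2)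
    (fun i _ => sq_nonneg _) (Finset.mem_univ i))

theorem abs_dmode_le {L : ℝ} (hL : 0 < L) (i : Fin 2) (k : Mode) (x : Plane) :
    |dmode L i k x| ≤ 2 / L * √(eigenvalue L k) := by
  rw [dmode, abs_mul, mul_comm]
  exact mul_le_mul (abs_mode_le hL _ _) (abs_freq_comp_le k i) (abs_nonneg _) (by positivity)

theorem abs_dshellSum_le {L : ℝ} (hL : 0 < L) (i : Fin 2) (c : Mode → ℝ) (j : ℕ) (x : Plane) :
    |dshellSum L i c j x| ≤ 2 / L * ∑ k ∈ shell j, √(eigenvalue L k) * |c k| := by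
  rw [Finset.mul_sum]
  refine (Finset.abs_sum_le_sum_abs _ _).trans (Finset.sum_le_sum fun k _ => ?_)
  rw [abs_mul, mul_comm, ← mul_assoc]
  exact mul_le_mul_of_nonneg_right (abs_dmode_le hL i k x) (abs_nonneg _)

theorem abs_shellSum_le {L : ℝ} (hL : 0 < L) (c : Mode → ℝ) (j : ℕ) (x : Plane) :
    |shellSum L c j x| ≤ 2 / L * ∑ k ∈ shell j, |c k| := by
  rw [Finset.mul_sum]
  refine (Finset.abs_sum_le_sum_abs _ _).trans (Finset.sum_le_sum fun k _ => ?_)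
  rw [abs_mul, mul_comm]
  exact mul_le_mul_of_nonneg_right (abs_mode_le hL k x) (abs_nonneg _)

theorem shellSummable_of_sum_le {L K : ℝ} (hL : 0 < L) {c : Mode → ℝ}
    (hK : ∀ F : Finset Mode, ∑ k ∈ F, √(eigenvalue L k) * |c k| ≤ K) : ShellSummable L c := by
  have hs := summable_sum_shell (fun k => by positivity) hK
  have hp : 0 < L / (2 * Real.pi) := by
    have := Real.pi_pos
    positivity
  -- The summand `1` serves the derivatives, and `L/(2π)` serves the function itself, since `(L/2π)
  -- √μ_k = |k| ≥ 1`.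
  refine ⟨_, hs.mul_left (2 / L * (1 + L / (2 * Real.pi))), fun j x => ⟨?_, fun i => ?_⟩⟩
  · refine (abs_shellSum_le hL c j x).trans ?_
    rw [mul_assoc]
    refine mul_le_mul_of_nonneg_left ?_ (by positivity)
    rw [Finset.mul_sum]
    refine Finset.sum_le_sum fun k _ => ?_
    rw [← mul_assoc]
    refine le_mul_of_one_le_left (abs_nonneg _) ?_
    have h1 : L / (2 * Real.pi) * √(eigenvalue L k) = modeNorm k := by
      have := Real.pi_pos
      rw [sqrt_eigenvalue hL]
      field_simp
    rw [add_mul, h1, one_mul]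
    have := one_le_modeNorm k
    linarith [Real.sqrt_nonneg (eigenvalue L k)]
  · refine (abs_dshellSum_le hL i c j x).trans ?_
    have : 0 ≤ ∑ k ∈ shell j, √(eigenvalue L k) * |c k| := Finset.sum_nonneg fun k _ => by positivity
    refine mul_le_mul_of_nonneg_right ?_ this
    refine le_mul_of_one_le_right (by positivity) (by linarith)

theorem abs_tsum_dshellSum_le {L K : ℝ} (hL : 0 < L) {c : Mode → ℝ}
    (hK : ∀ F : Finset Mode, ∑ k ∈ F, √(eigenvalue L k) * |c k| ≤ K) (i : Fin 2) (x : Plane) :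
    |∑' j, dshellSum L i c j x| ≤ 2 / L * K := by
  have hs := summable_sum_shell (fun k => by positivity) hK
  have h := tsum_of_norm_bounded (f := fun j => dshellSum L i c j x)
    (hs.mul_left (2 / L)).hasSum fun j => abs_dshellSum_le hL i c j x
  refine h.trans ?_
  rw [tsum_mul_left]
  exact mul_le_mul_of_nonneg_left (tsum_sum_shell_le (fun k => by positivity) hK) (by positivity)

/-! ### Discretization of the torus -/

theorem abs_trig_sub_le {L : ℝ} (hL : 0 < L) (m : ℤ) (y z : ℝ) :
    |trig L m y - trig L m z| ≤ √(2 / L) * |freq L m| * |y - z| := by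
  have h := Convex.norm_image_sub_le_of_norm_hasDerivWithin_le (s := univ) (x := z) (y := y)
    (C := √(2 / L) * |freq L m|)
    (fun w _ => (hasDerivAt_trig L m w).hasDerivWithinAt) (fun w _ => by
      rw [norm_mul, mul_comm]
      exact mul_le_mul_of_nonneg_right (abs_trig_le hL _ _) (norm_nonneg _))
    convex_univ (mem_univ _) (mem_univ _)
  simpa using h

theorem abs_mode_sub_le {L h : ℝ} (hL : 0 < L) (k : Mode) {x y : Plane}
    (hxy : ∀ i, |x i - y i| ≤ h) :
    |mode L k x - mode L k y| ≤ 4 / L * √(eigenvalue L k) * h := by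
  have hh : 0 ≤ h := (abs_nonneg _).trans (hxy 0)
  have hs : √(2 / L) * √(2 / L) = 2 / L := Real.mul_self_sqrt (by positivity)
  have h0 := abs_freq_comp_le (L := L) k 0
  have h1 := abs_freq_comp_le (L := L) k 1
  simp only [comp, if_true, one_ne_zero, if_false] at h0 h1
  have e0 : |trig L k.1.1 (x 0) - trig L k.1.1 (y 0)| ≤ √(2 / L) * √(eigenvalue L k) * h :=
    (abs_trig_sub_le hL _ _ _).trans (mul_le_mul (mul_le_mul_of_nonneg_left h0 (by positivity))
      (hxy 0) (abs_nonneg _) (by positivity))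
  have e1 : |trig L k.1.2 (x 1) - trig L k.1.2 (y 1)| ≤ √(2 / L) * √(eigenvalue L k) * h :=
    (abs_trig_sub_le hL _ _ _).trans (mul_le_mul (mul_le_mul_of_nonneg_left h1 (by positivity))
      (hxy 1) (abs_nonneg _) (by positivity))
  have e : mode L k x - mode L k y = (trig L k.1.1 (x 0) - trig L k.1.1 (y 0)) * trig L k.1.2 (x 1)
      + trig L k.1.1 (y 0) * (trig L k.1.2 (x 1) - trig L k.1.2 (y 1)) := by
    simp only [mode]; ring
  rw [e]
  refine (abs_add_le _ _).trans ?_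
  rw [abs_mul, abs_mul]
  calc _ ≤ √(2 / L) * √(eigenvalue L k) * h * √(2 / L)
        + √(2 / L) * (√(2 / L) * √(eigenvalue L k) * h) :=
        add_le_add (mul_le_mul e0 (abs_trig_le hL _ _) (abs_nonneg _) (by positivity))
          (mul_le_mul (abs_trig_le hL _ _) e1 (abs_nonneg _) (by positivity))
    _ = (√(2 / L) * √(2 / L)) * 2 * √(eigenvalue L k) * h := by ring
    _ = _ := by rw [hs]; ring

/-- The points of the uniform grid with mesh `L / N`. -/
def gridPoint (L : ℝ) (N : ℕ) (p : ℕ × ℕ) : Plane := !₂[L * p.1 / N, L * p.2 / N]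

theorem exists_nat_abs_sub_le {L : ℝ} (hL : 0 < L) {N : ℕ} (hN : 0 < N) (x : ℝ) :
    ∃ p < N, ∃ z : ℤ, |x - (L * p / N + z * L)| ≤ L / N := by
  have hN' : (0 : ℝ) < N := by exact_mod_cast hN
  have hN'' : (N : ℤ) ≠ 0 := by exact_mod_cast hN.ne'
  set m := ⌊x * N / L⌋ with hm
  refine ⟨(m % N).toNat, ?_, m / N, ?_⟩
  · have := Int.emod_lt_of_pos m (by exact_mod_cast hN : (0 : ℤ) < N)
    have := Int.emod_nonneg m hN''
    omega
  · have h1 : (((m % N).toNat : ℕ) : ℝ) = ((m % N : ℤ) : ℝ) := by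
      rw [← Int.cast_natCast, Int.toNat_of_nonneg (Int.emod_nonneg m hN'')]
    have h2 : ((m % N : ℤ) : ℝ) = m - N * ((m / N : ℤ) : ℝ) := by
      rw [Int.emod_def]; push_cast; ring
    have h3 : L * (((m % N).toNat : ℕ) : ℝ) / N + ((m / N : ℤ) : ℝ) * L = m * L / N := by
      rw [h1, h2]; field_simp; ring
    rw [h3]
    have h4 := Int.floor_le (x * N / L)
    have h5 := Int.lt_floor_add_one (x * N / L)
    rw [← hm] at h4 h5
    rw [le_div_iff₀ hL] at h4
    rw [div_lt_iff₀ hL] at h5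
    rw [abs_le]
    constructor
    · have : m * L / N ≤ x := by rw [div_le_iff₀ hN']; exact h4
      have : 0 ≤ L / N := by positivity
      linarith
    · have : x ≤ (m + 1) * L / N := by rw [le_div_iff₀ hN']; exact h5.le
      have : (m + 1) * L / N = m * L / N + L / N := by ring
      linarith

theorem trig_add_int_mul {L : ℝ} (hL : 0 < L) (m z : ℤ) (y : ℝ) :
    trig L m (y + z * L) = trig L m y :=
  Function.Periodic.int_mul (trig_add_period hL m) z y

/-- Periodicity moves `x` next to a point of the finite grid. One grid point serves all modes
simultaneously, as sums over `k` require. -/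
theorem exists_gridPoint {L : ℝ} (hL : 0 < L) {N : ℕ} (hN : 0 < N) (x : Plane) :
    ∃ p ∈ Finset.range N ×ˢ Finset.range N, ∀ k,
      |mode L k x - mode L k (gridPoint L N p)| ≤ 4 / L * √(eigenvalue L k) * (L / N) := by
  obtain ⟨p, hp, z, hz⟩ := exists_nat_abs_sub_le hL hN (x 0)
  obtain ⟨q, hq, w, hw⟩ := exists_nat_abs_sub_le hL hN (x 1)
  refine ⟨(p, q), by simp [hp, hq], fun k => ?_⟩
  have e : mode L k (gridPoint L N (p, q))
      = mode L k !₂[L * p / N + z * L, L * q / N + w * L] := by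
    simp [mode, gridPoint, trig_add_int_mul hL]
  rw [e]
  refine abs_mode_sub_le hL k fun i => ?_
  fin_cases i
  · simpa using hz
  · simpa using hw

theorem eigenvalue_reflect (L : ℝ) (i : Fin 2) (k : Mode) :
    eigenvalue L (reflect i k) = eigenvalue L k := by
  fin_cases i <;> simp [eigenvalue, modeNorm, reflect]

/-- The shell sums of a partial derivative on the torus are controlled by their values on a grid. -/
theorem exists_abs_dshellSum_sub_le {L : ℝ} (hL : 0 < L) {N : ℕ} (hN : 0 < N) (c : Mode → ℝ) (j : ℕ)
    (x : Plane) : ∃ p ∈ Finset.range N ×ˢ Finset.range N, ∀ i,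
      |dshellSum L i c j x - dshellSum L i c j (gridPoint L N p)|
        ≤ 4 / N * ∑ k ∈ shell j, eigenvalue L k * |c k| := by
  obtain ⟨p, hp, h⟩ := exists_gridPoint hL hN x
  refine ⟨p, hp, fun i => ?_⟩
  rw [dshellSum, dshellSum, ← Finset.sum_sub_distrib, Finset.mul_sum]
  refine (Finset.abs_sum_le_sum_abs _ _).trans (Finset.sum_le_sum fun k _ => ?_)
  have h1 := h (reflect i k)
  rw [eigenvalue_reflect] at h1
  rw [← mul_sub, dmode, dmode, ← mul_sub, abs_mul, abs_mul]
  calc |c k| * (|freq L (comp k i)| * |mode L (reflect i k) x - mode L (reflect i k) (gridPoint L N p)|)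
      ≤ |c k| * (√(eigenvalue L k) * (4 / L * √(eigenvalue L k) * (L / N))) := by
        gcongr
        exact abs_freq_comp_le k i
    _ = 4 / N * ((√(eigenvalue L k) * √(eigenvalue L k)) * |c k|) := by field_simp
    _ = _ := by rw [Real.mul_self_sqrt (eigenvalue_pos hL k).le]

/-! ### Regularity of the stochastic convolution -/

/-- The Fourier coefficients of the stochastic convolution with noise `∑ a_k β_k e_k`. -/
def noise {Ω : Type*} (L : ℝ) (β : Mode → ℝ≥0 → Ω → ℝ) (a : Mode → ℝ) (t : ℝ) (ω : Ω) (k : Mode) : ℝ :=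
  a k * convCoeff L β t ω k

/-- The variance of `dshellSum L i (noise L β a t ω) j x`. -/
def shellVar (L t : ℝ) (a : Mode → ℝ) (i : Fin 2) (x : Plane) (F : Finset Mode) : ℝ≥0 :=
  ∑ k ∈ F, Real.toNNReal ((a k * dmode L i k x) ^ 2) * convVar t (eigenvalue L k ^ 2)

theorem coe_shellVar (L t : ℝ) (a : Mode → ℝ) (i : Fin 2) (x : Plane) (F : Finset Mode) :
    (shellVar L t a i x F : ℝ)
      = ∑ k ∈ F, (a k * dmode L i k x) ^ 2 * convVar t (eigenvalue L k ^ 2) := by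
  simp only [shellVar, NNReal.coe_sum, NNReal.coe_mul, Real.coe_toNNReal _ (sq_nonneg _)]

section

variable {Ω : Type*} [MeasurableSpace Ω] {P : Measure Ω} [IsProbabilityMeasure P]
  {L t : ℝ} {β : Mode → ℝ≥0 → Ω → ℝ}

theorem hasLaw_dshellSum_noise (hL : 0 < L) (ht : 0 ≤ t) (hβ : IsCylindricalWiener β P)
    (a : Mode → ℝ) (i : Fin 2) (j : ℕ) (x : Plane) :
    HasLaw (fun ω => dshellSum L i (noise L β a t ω) j x)
      (gaussianReal 0 (shellVar L t a i x (shell j))) P := by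
  have h := hasLaw_sum_convCoeff hL ht hβ (shell j) fun k => a k * dmode L i k x
  have e : (fun ω => dshellSum L i (noise L β a t ω) j x)
      = fun ω => ∑ k ∈ shell j, a k * dmode L i k x * convCoeff L β t ω k := by
    funext ω
    exact Finset.sum_congr rfl fun k _ => by simp only [noise]; ring
  rw [e]
  exact h

/-- The `k`-th term is of order `|k|^{-2-2δ}`. One factor `|k|^{-δ}` is at most `2^{-δj}` on the
shell; the other keeps `|k|^{-2-δ}` summable. -/
theorem exists_shellVar_le (hL : 0 < L) (t : ℝ) {a : Mode → ℝ} {δ C : ℝ} (hδ : 0 < δ)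
    (ha : ∀ k, |a k| ≤ C * modeNorm k ^ (-δ)) : ∃ A : ℝ, 0 ≤ A ∧ ∀ i x j,
      (shellVar L t a i x (shell j) : ℝ) ≤ A * ((2 : ℝ) ^ (-δ)) ^ j := by
  have hsum := summable_modeNorm_rpow (a := 2 + δ) (by linarith)
  have hpos (k : Mode) : 0 ≤ modeNorm k ^ (-(2 + δ)) := by have := modeNorm_pos k; positivity
  set S := ∑' k, modeNorm k ^ (-(2 + δ)) with hS
  set A₀ := C ^ 2 * (2 / L) ^ 2 / (2 * (2 * Real.pi / L) ^ 2) with hA₀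
  refine ⟨A₀ * S, by have : 0 ≤ S := tsum_nonneg hpos; positivity, fun i x j => ?_⟩
  rw [coe_shellVar]
  calc _ ≤ ∑ k ∈ shell j, A₀ * ((2 : ℝ) ^ (-δ)) ^ j * modeNorm k ^ (-(2 + δ)) := by
        refine Finset.sum_le_sum fun k hk => ?_
        have hm := modeNorm_pos k
        have hμ := eigenvalue_pos hL k
        have h1 : (a k * dmode L i k x) ^ 2
            ≤ (C * modeNorm k ^ (-δ)) ^ 2 * ((2 / L) ^ 2 * eigenvalue L k) := by
          rw [mul_pow, ← sq_abs (a k), ← sq_abs (dmode L i k x)]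
          have h2 : |dmode L i k x| ^ 2 ≤ (2 / L * √(eigenvalue L k)) ^ 2 := by
            gcongr
            exact abs_dmode_le hL i k x
          rw [mul_pow, Real.sq_sqrt hμ.le] at h2
          gcongr
          exact ha k
        have h2 := convVar_le (t := t) (l := eigenvalue L k ^ 2) (by positivity)
        have h3 := eigenvalue_eq_mul_modeNorm_sq L k
        have h4 : modeNorm k ^ (-δ) ≤ ((2 : ℝ) ^ (-δ)) ^ j := by
          rw [← Real.rpow_natCast, ← Real.rpow_mul zero_le_two, mul_comm, Real.rpow_mul zero_le_two,
            Real.rpow_natCast]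
          exact Real.rpow_le_rpow_of_nonpos (by positivity) (two_pow_le_modeNorm hk) (by linarith)
        have h5 := modeNorm_rpow_neg_two_add k δ
        have hpi := Real.pi_pos
        calc _ ≤ (C * modeNorm k ^ (-δ)) ^ 2 * ((2 / L) ^ 2 * eigenvalue L k)
              * (1 / (2 * eigenvalue L k ^ 2)) := by gcongr
          _ = A₀ * modeNorm k ^ (-δ) * modeNorm k ^ (-(2 + δ)) := by
              rw [h5, h3, hA₀]
              field_simp
          _ ≤ _ := by gcongr
    _ ≤ A₀ * ((2 : ℝ) ^ (-δ)) ^ j * S := by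
        rw [← Finset.mul_sum]
        gcongr
        exact hsum.sum_le_tsum _ fun k _ => hpos k
    _ = _ := by ring

/-- First moments are of order `|k|^{-2-δ}`, which is summable in dimension two. This controls the
function itself and the error between grid points. -/
theorem ae_summable_noise (hL : 0 < L) (ht : 0 ≤ t) (hβ : IsCylindricalWiener β P)
    {a : Mode → ℝ} {δ C : ℝ} (hδ : 0 < δ) (ha : ∀ k, |a k| ≤ C * modeNorm k ^ (-δ)) :
    ∀ᵐ ω ∂P, Summable fun k => |noise L β a t ω k| := by
  set M := ∫⁻ x, ‖x‖ₑ ^ 1 ∂(gaussianReal 0 1) with hM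
  have hMlt : M < ∞ := lintegral_enorm_pow_gaussianReal_lt_top 1
  have hlaw (k : Mode) : HasLaw (fun ω => noise L β a t ω k)
      (gaussianReal 0 (Real.toNNReal (a k ^ 2) * convVar t (eigenvalue L k ^ 2))) P := by
    simpa [noise] using hasLaw_sum_convCoeff hL ht hβ {k} a
  set D := C / (2 * Real.pi / L) ^ 2 with hD
  have hb (k : Mode) : ∫⁻ ω, ‖noise L β a t ω k‖ₑ ∂P
      ≤ ENNReal.ofReal (D * modeNorm k ^ (-(2 + δ))) * M := by
    have h := lintegral_enorm_pow_of_hasLaw (hlaw k) 1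
    simp only [pow_one] at h hM
    rw [h, ← hM, ← ofReal_norm, Real.norm_of_nonneg (Real.sqrt_nonneg _)]
    gcongr
    have hm := modeNorm_pos k
    have hμ := eigenvalue_pos hL k
    have hpi := Real.pi_pos
    have h2 := convVar_le (t := t) (l := eigenvalue L k ^ 2) (by positivity)
    have h3 := eigenvalue_eq_mul_modeNorm_sq L k
    have h5 := modeNorm_rpow_neg_two_add k δ
    have h6 : D * modeNorm k ^ (-(2 + δ)) = C * modeNorm k ^ (-δ) / eigenvalue L k := by
      rw [hD, h5, h3]
      field_simp
    rw [h6]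
    calc _ ≤ √((|a k| / eigenvalue L k) ^ 2) := by
          apply Real.sqrt_le_sqrt
          rw [NNReal.coe_mul, Real.coe_toNNReal _ (sq_nonneg _), div_pow, sq_abs, div_eq_mul_inv]
          gcongr
          refine h2.trans ?_
          rw [one_div]
          gcongr
          nlinarith [sq_nonneg (eigenvalue L k)]
      _ = |a k| / eigenvalue L k := Real.sqrt_sq (by positivity)
      _ ≤ _ := by
          gcongr
          exact ha k
  have hsum : Summable fun k => D * modeNorm k ^ (-(2 + δ)) :=
    (summable_modeNorm_rpow (by linarith)).mul_left _
  have hmeas (k : Mode) : AEMeasurable (fun ω => ‖noise L β a t ω k‖ₑ) P :=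
    (hlaw k).aemeasurable.enorm
  have hfin : ∫⁻ ω, ∑' k, ‖noise L β a t ω k‖ₑ ∂P < ∞ := by
    rw [lintegral_tsum hmeas]
    calc _ ≤ ∑' k, ENNReal.ofReal (D * modeNorm k ^ (-(2 + δ))) * M := ENNReal.tsum_le_tsum hb
      _ = (∑' k, ENNReal.ofReal (D * modeNorm k ^ (-(2 + δ)))) * M := ENNReal.tsum_mul_right
      _ < ∞ := ENNReal.mul_lt_top hsum.tsum_ofReal_lt_top hMlt
  filter_upwards [ae_lt_top' (AEMeasurable.tsum hmeas) hfin.ne] with ω hω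
  have := ENNReal.summable_toReal hω.ne
  simpa using this

/-- The standard deviation on shell `j` is of order `r^{2j}`. After division by `r^j`, a high moment
still decays fast enough to beat the number of grid points, so the sum of all these moments has
finite expectation. -/
theorem ae_bounded_dshellSum_noise_gridPoint (hL : 0 < L) (ht : 0 ≤ t)
    (hβ : IsCylindricalWiener β P) {a : Mode → ℝ} {δ C : ℝ} (hδ : 0 < δ)
    (ha : ∀ k, |a k| ≤ C * modeNorm k ^ (-δ)) :
    ∃ r : ℝ, 0 < r ∧ r < 1 ∧ ∀ᵐ ω ∂P, ∃ B : ℝ, ∀ j i,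
      ∀ p ∈ Finset.range (16 ^ j) ×ˢ Finset.range (16 ^ j),
        |dshellSum L i (noise L β a t ω) j (gridPoint L (16 ^ j) p)| ≤ B * r ^ j := by
  obtain ⟨A, hA, hvar⟩ := exists_shellVar_le hL t hδ ha
  set r : ℝ := 2 ^ (-(δ / 4)) with hr
  have hr0 : 0 < r := by positivity
  have hr1 : r < 1 := Real.rpow_lt_one_of_one_lt_of_neg one_lt_two (by linarith)
  have hr4 : (2 : ℝ) ^ (-δ) = r ^ 4 := by
    rw [hr, ← Real.rpow_natCast, ← Real.rpow_mul zero_le_two]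
    congr 1
    push_cast
    ring
  -- Here `512 = 2 · 16²`: the grid has `256^j` points, and `256 rⁿ < 1/2` leaves the summable
  -- factor `2^{-j}`.
  obtain ⟨n, hn⟩ := exists_pow_lt_of_lt_one (by norm_num : (0 : ℝ) < 1 / 512) hr1
  have hn0 : n ≠ 0 := by rintro rfl; norm_num at hn
  set M := ∫⁻ x, ‖x‖ₑ ^ n ∂(gaussianReal 0 1) with hM
  have hMlt : M < ∞ := lintegral_enorm_pow_gaussianReal_lt_top n
  set grid : ℕ → Finset (ℕ × ℕ) := fun j => Finset.range (16 ^ j) ×ˢ Finset.range (16 ^ j) with hgrid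
  set Y : ℕ → Fin 2 → ℕ × ℕ → Ω → ℝ := fun j i p ω =>
    (r⁻¹) ^ j * dshellSum L i (noise L β a t ω) j (gridPoint L (16 ^ j) p) with hY
  have hD := hasLaw_dshellSum_noise hL ht hβ a
  have hYm (j i p) : AEMeasurable (fun ω => ‖Y j i p ω‖ₑ ^ n) P :=
    ((hD i j _).aemeasurable.const_mul _).enorm.pow_const _
  have hYb (j i p) : ∫⁻ ω, ‖Y j i p ω‖ₑ ^ n ∂P ≤ ENNReal.ofReal ((√A * r ^ j) ^ n) * M := by
    have e : ∫⁻ ω, ‖Y j i p ω‖ₑ ^ n ∂P = ‖(r⁻¹) ^ j‖ₑ ^ n *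
        ∫⁻ ω, ‖dshellSum L i (noise L β a t ω) j (gridPoint L (16 ^ j) p)‖ₑ ^ n ∂P := by
      rw [← lintegral_const_mul'' _ ((hD i j _).aemeasurable.enorm.pow_const _)]
      simp only [hY, enorm_mul, mul_pow]
    rw [e, lintegral_enorm_pow_of_hasLaw (hD i j _) n, ← mul_assoc, ← mul_pow, ← enorm_mul,
      ← ofReal_norm, ENNReal.ofReal_pow (by positivity), norm_mul,
      Real.norm_of_nonneg (Real.sqrt_nonneg _), Real.norm_of_nonneg (by positivity)]
    refine mul_le_mul' (pow_le_pow_left' (ENNReal.ofReal_le_ofReal ?_) n) le_rfl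
    calc (r⁻¹) ^ j * √(shellVar L t a i (gridPoint L (16 ^ j) p) (shell j) : ℝ)
        ≤ (r⁻¹) ^ j * √(A * ((r ^ j) ^ 2) ^ 2) := by
          gcongr
          refine (hvar _ _ _).trans_eq ?_
          rw [hr4]
          ring
      _ = (r⁻¹) ^ j * (√A * (r ^ j) ^ 2) := by
          rw [Real.sqrt_mul hA, Real.sqrt_sq (by positivity)]
      _ = √A * r ^ j := by
          rw [inv_pow]
          field_simp
  set Q : ℕ → Ω → ℝ≥0∞ := fun j ω => ∑ i, ∑ p ∈ grid j, ‖Y j i p ω‖ₑ ^ n with hQ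
  have hQm (j) : AEMeasurable (Q j) P :=
    Finset.aemeasurable_fun_sum _ fun i _ => Finset.aemeasurable_fun_sum _ fun p _ => hYm j i p
  have hQb (j) : ∫⁻ ω, Q j ω ∂P ≤ ENNReal.ofReal (2 * √A ^ n * (1 / 2) ^ j) * M := by
    have e : ∫⁻ ω, Q j ω ∂P = ∑ i, ∑ p ∈ grid j, ∫⁻ ω, ‖Y j i p ω‖ₑ ^ n ∂P := by
      rw [lintegral_finsetSum' _ fun i _ => Finset.aemeasurable_fun_sum _ fun p _ => hYm j i p]
      exact Finset.sum_congr rfl fun i _ => lintegral_finsetSum' _ fun p _ => hYm j i p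
    rw [e]
    calc _ ≤ ∑ _i : Fin 2, ∑ _p ∈ grid j, ENNReal.ofReal ((√A * r ^ j) ^ n) * M :=
          Finset.sum_le_sum fun i _ => Finset.sum_le_sum fun p _ => hYb j i p
      _ = ENNReal.ofReal (2 * 256 ^ j * (√A * r ^ j) ^ n) * M := by
          simp only [Finset.sum_const, Finset.card_univ, Fintype.card_fin, nsmul_eq_mul, hgrid,
            Finset.card_product, Finset.card_range]
          rw [ENNReal.ofReal_mul (by positivity), ENNReal.ofReal_mul (by positivity),
            ENNReal.ofReal_pow (by positivity), ENNReal.ofReal_pow (by norm_num : (0 : ℝ) ≤ 256)]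
          push_cast
          rw [ENNReal.ofReal_ofNat, ENNReal.ofReal_ofNat, ← mul_pow]
          norm_num
          ring
      _ ≤ _ := by
          refine mul_le_mul' (ENNReal.ofReal_le_ofReal ?_) le_rfl
          calc 2 * 256 ^ j * (√A * r ^ j) ^ n = 2 * √A ^ n * (256 * r ^ n) ^ j := by ring
            _ ≤ _ := by
              gcongr
              linarith
  have hfin : ∫⁻ ω, ∑' j, Q j ω ∂P < ∞ := by
    rw [lintegral_tsum hQm]
    calc _ ≤ ∑' j : ℕ, ENNReal.ofReal (2 * √A ^ n * (1 / 2) ^ j) * M := ENNReal.tsum_le_tsum hQb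
      _ = (∑' j : ℕ, ENNReal.ofReal (2 * √A ^ n * (1 / 2) ^ j)) * M := ENNReal.tsum_mul_right
      _ < ∞ := ENNReal.mul_lt_top (Summable.tsum_ofReal_lt_top
          (summable_geometric_two.mul_left _)) hMlt
  refine ⟨r, hr0, hr1, ?_⟩
  filter_upwards [ae_lt_top' (AEMeasurable.tsum hQm) hfin.ne] with ω hω
  refine ⟨1 + (∑' j, Q j ω).toReal, fun j i p hp => ?_⟩
  have h1 : ‖Y j i p ω‖ₑ ^ n ≤ ∑' j, Q j ω :=
    calc ‖Y j i p ω‖ₑ ^ n ≤ ∑ p ∈ grid j, ‖Y j i p ω‖ₑ ^ n :=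
          Finset.single_le_sum (f := fun p => ‖Y j i p ω‖ₑ ^ n) (fun _ _ => zero_le) hp
      _ ≤ Q j ω := Finset.single_le_sum (f := fun i => ∑ p ∈ grid j, ‖Y j i p ω‖ₑ ^ n)
          (fun _ _ => zero_le) (Finset.mem_univ i)
      _ ≤ _ := ENNReal.le_tsum j
  have h2 : |Y j i p ω| ^ n ≤ (∑' j, Q j ω).toReal := by
    have := ENNReal.toReal_mono hω.ne h1
    simpa using this
  have h3 : |Y j i p ω| ≤ 1 + (∑' j, Q j ω).toReal := by
    rcases le_total |Y j i p ω| 1 with h | h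
    · exact h.trans (by linarith [ENNReal.toReal_nonneg (a := ∑' j, Q j ω)])
    · linarith [le_self_pow₀ h hn0]
  rw [hY, abs_mul, abs_of_pos (by positivity), inv_pow, inv_mul_le_iff₀ (by positivity)] at h3
  linarith

/-- Grid values decay geometrically. Off the grid the error is of order `16^{-j} ∑ μ_k |c_k|`, with
`μ_k` of order `4^j` on the shell and `∑ |c_k|` finite; the mesh `L/16^j` therefore leaves `4^{-j}`.
-/
theorem ae_shellSummable_noise (hL : 0 < L) (ht : 0 ≤ t) (hβ : IsCylindricalWiener β P)
    {a : Mode → ℝ} {δ C : ℝ} (hδ : 0 < δ) (ha : ∀ k, |a k| ≤ C * modeNorm k ^ (-δ)) :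
    ∀ᵐ ω ∂P, ShellSummable L (noise L β a t ω) := by
  obtain ⟨r, hr0, hr1, hB⟩ := ae_bounded_dshellSum_noise_gridPoint hL ht hβ hδ ha
  filter_upwards [hB, ae_summable_noise hL ht hβ hδ ha] with ω ⟨B, hB⟩ hsum
  set c := noise L β a t ω
  set W := ∑' k, |c k| with hW
  have hWF (F : Finset Mode) : ∑ k ∈ F, |c k| ≤ W := hsum.sum_le_tsum F fun k _ => abs_nonneg _
  set D := 4 * ((2 * Real.pi / L) ^ 2 * 16) with hD
  have hD0 : 0 ≤ D := by positivity
  have hW0 : 0 ≤ W := tsum_nonneg fun k => abs_nonneg _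
  have hB0 : 0 ≤ B := by simpa using (abs_nonneg _).trans (hB 0 0 (0, 0) (by simp))
  have hshell := (summable_sum_shell (fun k => abs_nonneg (c k)) hWF).mul_left (2 / L)
  have hgeo := ((summable_geometric_of_lt_one hr0.le hr1).mul_left B).add
    ((summable_geometric_of_lt_one (by norm_num) (by norm_num : (1 / 4 : ℝ) < 1)).mul_left (D * W))
  have hnn (j : ℕ) : 0 ≤ 2 / L * ∑ k ∈ shell j, |c k| :=
    mul_nonneg (by positivity) (Finset.sum_nonneg fun k _ => abs_nonneg _)
  refine ⟨_, hgeo.add hshell, fun j x => ⟨?_, fun i => ?_⟩⟩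
  · have : 0 ≤ B * r ^ j + D * W * (1 / 4) ^ j := by positivity
    linarith [abs_shellSum_le hL c j x]
  · obtain ⟨p, hp, h⟩ := exists_abs_dshellSum_sub_le hL (N := 16 ^ j) (by positivity) c j x
    have h1 := hB j i p hp
    have h2 : 4 / ((16 ^ j : ℕ) : ℝ) * ∑ k ∈ shell j, eigenvalue L k * |c k|
        ≤ D * W * (1 / 4) ^ j := by
      calc _ ≤ 4 / ((16 ^ j : ℕ) : ℝ) *
            ∑ k ∈ shell j, ((2 * Real.pi / L) ^ 2 * (4 * 2 ^ j) ^ 2) * |c k| := by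
            gcongr with k hk
            have := modeNorm_pos k
            rw [eigenvalue_eq_mul_modeNorm_sq]
            gcongr
            exact modeNorm_le_two_pow hk
        _ ≤ 4 / ((16 ^ j : ℕ) : ℝ) * (((2 * Real.pi / L) ^ 2 * (4 * 2 ^ j) ^ 2) * W) := by
            rw [← Finset.mul_sum]
            gcongr
            exact hWF _
        _ = D * W * (1 / 4) ^ j := by
            have e1 : ((16 ^ j : ℕ) : ℝ) = 4 ^ j * 4 ^ j := by
              push_cast
              rw [← mul_pow]
              norm_num
            have e2 : ((2 : ℝ) ^ j) ^ 2 = 4 ^ j := by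
              rw [← pow_mul, mul_comm, pow_mul]
              norm_num
            rw [e1, mul_pow 4, e2, one_div, inv_pow, hD]
            field_simp
            ring
    have h3 := h i
    have h4 := hnn j
    have h5 := abs_sub_abs_le_abs_sub (dshellSum L i c j x) (dshellSum L i c j (gridPoint L (16 ^ j) p))
    linarith

end

/-! ### Divergence of the variance -/

/-- The nonzero integer of modulus `m + 1` with the given sign. -/
def signed (s : Bool) (m : ℕ) : ℤ := if s then (m : ℤ) + 1 else -((m : ℤ) + 1)

/-- The mode `(±(m + 1), ±(n + 1))`. -/
def signedMode (q : (Σ _ : ℕ, ℕ) × Bool × Bool) : Mode :=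
  ⟨(signed q.2.1 q.1.1, signed q.2.2 q.1.2), fun h => by
    have h1 := congrArg Prod.fst h
    simp only [signed, Prod.fst_zero] at h1
    split_ifs at h1 <;> omega⟩

theorem signed_inj {s s' : Bool} {m m' : ℕ} (h : signed s m = signed s' m') : m = m' ∧ s = s' := by
  cases s <;> cases s' <;> simp only [signed, if_true, if_false, Bool.false_eq_true] at h ⊢ <;>
    first | exact ⟨by omega, trivial⟩ | omega

theorem signedMode_injective : Function.Injective signedMode := by
  rintro ⟨⟨m, n⟩, s, s'⟩ ⟨⟨m', n'⟩, r, r'⟩ h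
  have h0 := congrArg Subtype.val h
  obtain ⟨rfl, rfl⟩ := signed_inj (congrArg Prod.fst h0)
  obtain ⟨rfl, rfl⟩ := signed_inj (congrArg Prod.snd h0)
  rfl

theorem sum_trig_signed_sq {L : ℝ} (hL : 0 < L) (m : ℕ) (z : ℝ) :
    ∑ s, trig L (signed s m) z ^ 2 = 2 / L := by
  rw [Fintype.sum_bool]
  exact trig_sq_add_trig_neg_sq hL (m := (m : ℤ) + 1) (by omega) z

/-- Changing signs exchanges sine and cosine in each variable, so `sin² + cos² = 1` makes the sum
independent of `x`. This is what makes the variance bound uniform in space. -/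
theorem sum_dmode_signedMode_sq {L : ℝ} (hL : 0 < L) (m n : ℕ) (x : Plane) :
    ∑ s : Bool × Bool, dmode L 0 (signedMode (⟨m, n⟩, s)) x ^ 2
      = freq L (m + 1 : ℕ) ^ 2 * (2 / L) ^ 2 := by
  have hf (s : Bool) : freq L (signed s m) ^ 2 = freq L (m + 1 : ℕ) ^ 2 := by
    cases s
    · simp only [signed, Bool.false_eq_true, if_false, freq_neg, neg_sq]
      push_cast
      rfl
    · simp [signed]
  have hn (s : Bool) : -signed s m = signed (!s) m := by cases s <;> simp [signed]
  have e (s : Bool × Bool) : dmode L 0 (signedMode (⟨m, n⟩, s)) x ^ 2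
      = freq L (m + 1 : ℕ) ^ 2 *
        (trig L (signed (!s.1) m) (x 0) ^ 2 * trig L (signed s.2 n) (x 1) ^ 2) := by
    simp only [dmode, comp, reflect, mode, signedMode, if_true]
    rw [hn, mul_pow, mul_pow, hf]
  simp only [e, ← Finset.mul_sum, Fintype.sum_prod_type, sum_trig_signed_sq hL, ← Finset.sum_mul]
  have h2 : ∑ s : Bool, trig L (signed (!s) m) (x 0) ^ 2 = 2 / L := by
    rw [← sum_trig_signed_sq hL m (x 0)]
    exact Equiv.sum_comp Equiv.boolNot fun s => trig L (signed s m) (x 0) ^ 2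
  rw [h2, sq (2 / L)]

/-- Since `|k| ≥ 1`, the factor `1 - exp(-2 μ_k² t)` is smallest at the lowest eigenvalue. -/
theorem exists_convVar_ge {L t : ℝ} (hL : 0 < L) (ht : 0 < t) : ∃ q : ℝ, 0 < q ∧
    ∀ k, q / eigenvalue L k ^ 2 ≤ convVar t (eigenvalue L k ^ 2) := by
  have hpi := Real.pi_pos
  set e := ((2 * Real.pi / L) ^ 2) ^ 2 with he
  have he0 : 0 < e := by positivity
  refine ⟨(1 - Real.exp (-(2 * e * t))) / 2, ?_, fun k => ?_⟩
  · have : Real.exp (-(2 * e * t)) < 1 := by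
      rw [← Real.exp_zero, Real.exp_lt_exp]
      have : 0 < 2 * e * t := by positivity
      linarith
    linarith
  · have hμ := eigenvalue_pos hL k
    have h1 : e ≤ eigenvalue L k ^ 2 := by
      have h3 := eigenvalue_eq_mul_modeNorm_sq L k
      rw [h3, he, mul_pow]
      exact le_mul_of_one_le_right (by positivity) (one_le_pow₀ (one_le_pow₀ (one_le_modeNorm k)))
    rw [convVar, div_div]
    refine le_trans ?_ (Real.le_coe_toNNReal _)
    gcongr

/-- The variance of the gradient of the stochastic convolution is at least any given bound, as soon
as sufficiently many modes are excited. -/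
theorem exists_shellVar_ge {L t b : ℝ} (hL : 0 < L) (ht : 0 < t) (hb : 0 < b) (V : ℝ) :
    ∃ F : Finset Mode, ∀ a : Mode → ℝ, (∀ k ∈ F, b ≤ |a k|) →
      ∀ x, V ≤ shellVar L t a 0 x F := by
  obtain ⟨q, hq, hconv⟩ := exists_convVar_ge hL ht
  have hpi := Real.pi_pos
  set w := (2 * Real.pi / L) ^ 2 with hw
  have hw0 : 0 < w := by positivity
  -- The four modes `(±(m+1), ±(n+1))` with `n ≤ m` have `μ_k ≤ 2w(m+1)²`, so together they
  -- contribute at least `κ/(m+1)²`.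
  set κ := b ^ 2 * q * (2 / L) ^ 2 / (4 * w) with hκ
  have hκ0 : 0 < κ := by positivity
  obtain ⟨M, hM⟩ := ((Real.tendsto_sum_range_one_div_nat_succ_atTop.eventually_ge_atTop
    (V / κ)).exists)
  -- In this triangle each `m` occurs with `m + 1` values of `n`, which turns `κ/(m+1)²` into the
  -- harmonic term `κ/(m+1)`.
  set I := ((Finset.range M).sigma fun m => Finset.range (m + 1)) with hI
  refine ⟨(I ×ˢ Finset.univ).image signedMode, fun a ha x => ?_⟩
  rw [coe_shellVar, Finset.sum_image signedMode_injective.injOn, Finset.sum_product]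
  have hterm (p : Σ _ : ℕ, ℕ) (hp : p ∈ I) : κ / (p.1 + 1 : ℝ) ^ 2 ≤
      ∑ s : Bool × Bool, (a (signedMode (p, s)) * dmode L 0 (signedMode (p, s)) x) ^ 2
        * convVar t (eigenvalue L (signedMode (p, s)) ^ 2) := by
    obtain ⟨m, n⟩ := p
    have hnm : (n : ℝ) ≤ m := by
      rw [hI, Finset.mem_sigma, Finset.mem_range, Finset.mem_range] at hp
      exact_mod_cast Nat.lt_succ_iff.1 hp.2
    have hμ (s : Bool × Bool) : eigenvalue L (signedMode (⟨m, n⟩, s)) ≤ 2 * w * (m + 1 : ℝ) ^ 2 := by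
      have e1 (s : Bool) (m : ℕ) : ((signed s m : ℤ) : ℝ) ^ 2 = ((m : ℝ) + 1) ^ 2 := by
        cases s
        · simp only [signed, Bool.false_eq_true, if_false]
          push_cast
          ring
        · simp [signed]
      rw [eigenvalue, modeNorm, div_pow, mul_pow, Real.sq_sqrt (by positivity), hw, div_pow]
      simp only [signedMode, e1]
      have h : ((m : ℝ) + 1) ^ 2 + ((n : ℝ) + 1) ^ 2 ≤ 2 * ((m : ℝ) + 1) ^ 2 := by nlinarith
      calc _ = (2 * Real.pi) ^ 2 / L ^ 2 * (((m : ℝ) + 1) ^ 2 + ((n : ℝ) + 1) ^ 2) := by ring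
        _ ≤ (2 * Real.pi) ^ 2 / L ^ 2 * (2 * ((m : ℝ) + 1) ^ 2) := by gcongr
        _ = _ := by ring
    calc κ / (m + 1 : ℝ) ^ 2
        = ∑ s : Bool × Bool, b ^ 2 * dmode L 0 (signedMode (⟨m, n⟩, s)) x ^ 2
          * (q / (2 * w * (m + 1 : ℝ) ^ 2) ^ 2) := by
          rw [← Finset.sum_mul, ← Finset.mul_sum, sum_dmode_signedMode_sq hL]
          have : freq L (m + 1 : ℕ) ^ 2 = w * (m + 1 : ℝ) ^ 2 := by
            rw [freq, hw]
            push_cast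
            ring
          rw [this, hκ]
          field_simp
          ring
      _ ≤ _ := by
          refine Finset.sum_le_sum fun s _ => ?_
          rw [mul_pow (a _)]
          have h1 := ha _ (Finset.mem_image_of_mem signedMode
            (Finset.mk_mem_product hp (Finset.mem_univ s)))
          have h2 : b ^ 2 ≤ a (signedMode (⟨m, n⟩, s)) ^ 2 := by
            rw [← sq_abs (a _)]
            gcongr
          refine mul_le_mul (mul_le_mul_of_nonneg_right h2 (sq_nonneg _)) ?_ (by positivity)
            (by positivity)
          refine le_trans ?_ (hconv _)
          have := eigenvalue_pos hL (signedMode (⟨m, n⟩, s))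
          gcongr
          exact hμ s
  refine le_trans ?_ (Finset.sum_le_sum hterm)
  rw [hI, Finset.sum_sigma]
  calc V ≤ κ * ∑ i ∈ Finset.range M, 1 / ((i : ℝ) + 1) := by
        rwa [div_le_iff₀ hκ0, mul_comm] at hM
    _ = _ := by
        rw [Finset.mul_sum]
        refine Finset.sum_congr rfl fun m _ => ?_
        simp only [Finset.sum_const, Finset.card_range, nsmul_eq_mul]
        push_cast
        field_simp

theorem shellVar_mono (L t : ℝ) (a : Mode → ℝ) (i : Fin 2) (x : Plane) {F G : Finset Mode}
    (h : F ⊆ G) : shellVar L t a i x F ≤ shellVar L t a i x G :=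
  Finset.sum_le_sum_of_subset h

theorem exists_subset_box (F : Finset Mode) : ∃ J, ∀ J' ≥ J, F ⊆ box J' := by
  refine ⟨F.sup level + 1, fun J' hJ k hk => mem_box.2 ?_⟩
  have := Finset.le_sup (f := level) hk
  omega

/-! ### Anti-concentration of the gradient -/

/-- The indicator of an open interval is lower semicontinuous, so Fatou's lemma bounds the
probability for the infinite series by those for its finite Gaussian partial sums. The law of the
limit is never identified. -/
theorem lintegral_indicator_dnoise_le {Ω : Type*} [MeasurableSpace Ω] {P : Measure Ω}
    [IsProbabilityMeasure P] {L t : ℝ} {β : Mode → ℝ≥0 → Ω → ℝ}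
    (hL : 0 < L) (ht : 0 ≤ t) (hβ : IsCylindricalWiener β P)
    {a : Mode → ℝ} (ha : ∀ᵐ ω ∂P, ShellSummable L (noise L β a t ω)) (i : Fin 2) (x : Plane)
    {F : Finset Mode} {V : ℝ} (hV : 0 < V) (hF : V ≤ shellVar L t a i x F) {R : ℝ} (hR : 0 ≤ R) :
    ∫⁻ ω, (Ioo (-R) R).indicator 1 (∑' j, dshellSum L i (noise L β a t ω) j x) ∂P
      ≤ ENNReal.ofReal (2 * R / √V) := by
  set S : ℕ → Ω → ℝ := fun J ω => ∑ j ∈ Finset.range J, dshellSum L i (noise L β a t ω) j x with hS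
  have hlaw (J : ℕ) : HasLaw (S J) (gaussianReal 0 (shellVar L t a i x (box J))) P := by
    have h := hasLaw_sum_convCoeff hL ht hβ (box J) fun k => a k * dmode L i k x
    have e : S J = fun ω => ∑ k ∈ box J, a k * dmode L i k x * convCoeff L β t ω k := by
      funext ω
      rw [sum_box]
      exact Finset.sum_congr rfl fun j _ => Finset.sum_congr rfl fun k _ => by
        simp only [noise]; ring
    rw [e]
    exact h
  have hind : Measurable ((Ioo (-R) R).indicator (1 : ℝ → ℝ≥0∞)) :=
    measurable_one.indicator measurableSet_Ioo
  obtain ⟨J, hJ⟩ := exists_subset_box F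
  calc _ ≤ ∫⁻ ω, liminf (fun n => (Ioo (-R) R).indicator (1 : ℝ → ℝ≥0∞) (S n ω)) atTop ∂P := by
        refine lintegral_mono_ae ?_
        filter_upwards [ha] with ω hω
        have hlim := (hω.summable_dshellSum i x).hasSum.tendsto_sum_nat
        refine indicator_apply_le' (fun hmem => ?_) fun _ => zero_le
        refine le_liminf_of_le (by isBoundedDefault) ?_
        filter_upwards [hlim.eventually (isOpen_Ioo.mem_nhds hmem)] with n hn
        rw [indicator_of_mem (show S n ω ∈ Ioo (-R) R from hn)]
        rfl
    _ ≤ liminf (fun n => ∫⁻ ω, (Ioo (-R) R).indicator (1 : ℝ → ℝ≥0∞) (S n ω) ∂P) atTop :=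
        lintegral_liminf_le' fun n => hind.comp_aemeasurable (hlaw n).aemeasurable
    _ ≤ _ := by
        refine liminf_le_of_le (by isBoundedDefault) fun c hc => ?_
        -- A single index suffices, provided the box contains `F`: the variance only grows with the
        -- box.
        obtain ⟨n, hn, hn'⟩ := (hc.and (eventually_ge_atTop J)).exists
        refine hn.trans ?_
        have hv : V ≤ shellVar L t a i x (box n) :=
          hF.trans (NNReal.coe_le_coe.2 (shellVar_mono L t a i x (hJ n hn')))
        have hv0 : shellVar L t a i x (box n) ≠ 0 := fun h => by
          rw [h, NNReal.coe_zero] at hv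
          linarith
        rw [← lintegral_map' hind.aemeasurable (hlaw n).aemeasurable, (hlaw n).map_eq,
          lintegral_indicator_one measurableSet_Ioo]
        refine (measure_mono Ioo_subset_Icc_self).trans ((gaussianReal_Icc_le hv0 R).trans ?_)
        gcongr

/-! ### The mild solution -/

theorem norm_nonlin_le_inv {z : Plane} {r : ℝ} (hr : 0 < r) (h : r ≤ ‖z‖) : ‖nonlin z‖ ≤ r⁻¹ := by
  have hz := hr.trans_le h
  rw [norm_nonlin, div_le_iff₀ (by positivity), inv_mul_eq_div, le_div_iff₀ hr]
  nlinarith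

/-- The mild solution is the sum of a smooth part, bounded uniformly in the regularization, and of
the stochastic convolution. -/
theorem exists_decomposition {L T σ θ t : ℝ} (hL : 0 < L) (hθ : |θ| ≤ 1) (ht : t ∈ Ioc 0 T)
    {u₀ : Mode → ℝ} (hu₀ : MemSobolev L 1 u₀) : ∃ K : ℝ, 0 ≤ K ∧
      ∀ {Ω : Type*} [MeasurableSpace Ω] (P : Measure Ω) (β : Mode → ℝ≥0 → Ω → ℝ) (a : Mode → ℝ)
        (u : ℝ → Ω → Mode → ℝ), IsMildSolution P L T σ θ β a u₀ u →
        ∀ᵐ ω ∂P, ∃ A : Mode → ℝ, (∀ F : Finset Mode, ∑ k ∈ F, √(eigenvalue L k) * |A k| ≤ K) ∧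
          u t ω = A + noise L β (fun k => σ * a k) t ω := by
  obtain ⟨C, hC⟩ := exists_sum_driftCoeff_sq_le hL
  obtain ⟨K₁, h₁⟩ := exists_sum_semigroup_le hL ht.1 hu₀
  obtain ⟨K₂, h₂⟩ := exists_sum_duhamel_le (C := C) hL ht.1
  refine ⟨K₁ + K₂, ?_, fun P β a u hu => ?_⟩
  · have e1 := h₁ ∅
    have e2 := h₂ 0 (fun s F => by simpa using hC 0 ∅) ∅
    simp only [Finset.sum_empty] at e1 e2
    linarith
  filter_upwards [hu.mild] with ω hω
  refine ⟨fun k => Real.exp (-t * eigenvalue L k ^ 2) * u₀ k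
      + θ * (∫ s in (0 : ℝ)..t, Real.exp (-(t - s) * eigenvalue L k ^ 2) * driftCoeff L (u s ω) k),
    fun F => ?_, funext fun k => ?_⟩
  · refine le_trans (Finset.sum_le_sum fun k _ => ?_) ((Finset.sum_add_distrib).trans_le
      (add_le_add (h₁ F) (h₂ (fun s k => driftCoeff L (u s ω) k) (fun s F => hC _ F) F)))
    rw [← mul_add]
    refine mul_le_mul_of_nonneg_left ((abs_add_le _ _).trans ?_) (Real.sqrt_nonneg _)
    refine add_le_add le_rfl ?_
    rw [abs_mul]
    exact mul_le_of_le_one_left (abs_nonneg _) hθ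
  · rw [hω t ⟨ht.1.le, ht.2⟩ k]
    simp only [Pi.add_apply, noise]
    ring

/-- Split according to whether `∂₁` of the noise lies in `(-R, R)`. Inside, `|f| ≤ 1` and the event
is improbable. Outside, the smooth part removes at most `2K/L` from the derivative, so `|∇u| ≥ r`
and `|f|^p ≤ r^{-p} ≤ r⁻¹`. -/
theorem lintegral_nonlin_gradient_le {Ω : Type*} [MeasurableSpace Ω] {P : Measure Ω}
    [IsProbabilityMeasure P] {L t : ℝ} {β : Mode → ℝ≥0 → Ω → ℝ}
    (hL : 0 < L) (ht : 0 ≤ t) (hβ : IsCylindricalWiener β P)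
    {a : Mode → ℝ} (ha : ∀ᵐ ω ∂P, ShellSummable L (noise L β a t ω)) {c : Ω → Mode → ℝ} {K : ℝ}
    (hK : 0 ≤ K)
    (hc : ∀ᵐ ω ∂P, ∃ A : Mode → ℝ, (∀ F : Finset Mode, ∑ k ∈ F, √(eigenvalue L k) * |A k| ≤ K) ∧
      c ω = A + noise L β a t ω)
    (x : Plane) {F : Finset Mode} {V : ℝ} (hV : 0 < V) (hF : V ≤ shellVar L t a 0 x F)
    {r : ℝ} (hr : 1 ≤ r) {p : ℝ} (hp : 1 < p) :
    ∫⁻ ω, ENNReal.ofReal (‖nonlin (gradient (series L (c ω)) x)‖ ^ p) ∂P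
      ≤ ENNReal.ofReal (2 * (2 / L * K + r) / √V) + ENNReal.ofReal r⁻¹ := by
  have hr0 : 0 < r := one_pos.trans_le hr
  set R := 2 / L * K + r with hR
  calc _ ≤ ∫⁻ ω, ((Ioo (-R) R).indicator 1 (∑' j, dshellSum L 0 (noise L β a t ω) j x)
        + ENNReal.ofReal r⁻¹) ∂P := by
        refine lintegral_mono_ae ?_
        filter_upwards [ha, hc] with ω hω hcω
        obtain ⟨A, hA, hcA⟩ := hcω
        by_cases hmem : ∑' j, dshellSum L 0 (noise L β a t ω) j x ∈ Ioo (-R) R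
        · rw [indicator_of_mem hmem]
          refine le_trans ?_ le_self_add
          rw [Pi.one_apply, ENNReal.ofReal_le_one]
          exact Real.rpow_le_one (norm_nonneg _) (norm_nonlin_le_one _) (by linarith)
        · refine le_trans ?_ le_add_self
          refine ENNReal.ofReal_le_ofReal ?_
          have hAs := shellSummable_of_sum_le hL hA
          have hg : gradient (series L (c ω)) x 0 = (∑' j, dshellSum L 0 A j x)
              + ∑' j, dshellSum L 0 (noise L β a t ω) j x := by
            rw [hcA, (hAs.add hω).gradient_series,
              ← (hAs.summable_dshellSum 0 x).tsum_add (hω.summable_dshellSum 0 x)]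
            simp only [dshellSum_add]
          have h1 := abs_tsum_dshellSum_le hL hA 0 x
          have h2 : R ≤ |∑' j, dshellSum L 0 (noise L β a t ω) j x| := by
            rwa [mem_Ioo, ← abs_lt, not_lt] at hmem
          have h3 : r ≤ ‖gradient (series L (c ω)) x‖ := by
            refine le_trans ?_ (PiLp.norm_apply_le _ 0)
            rw [hg, Real.norm_eq_abs]
            have := abs_sub_abs_le_abs_sub (∑' j, dshellSum L 0 (noise L β a t ω) j x)
              (-∑' j, dshellSum L 0 A j x)
            rw [abs_neg, sub_neg_eq_add, add_comm (∑' j, dshellSum L 0 (noise L β a t ω) j x)] at this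
            linarith
          have h4 := norm_nonlin_le_inv hr0 h3
          calc ‖nonlin (gradient (series L (c ω)) x)‖ ^ p ≤ r⁻¹ ^ p :=
                Real.rpow_le_rpow (norm_nonneg _) h4 (by linarith)
            _ ≤ r⁻¹ ^ (1 : ℝ) := Real.rpow_le_rpow_of_exponent_ge (by positivity)
                (inv_le_one_of_one_le₀ hr) hp.le
            _ = r⁻¹ := Real.rpow_one _
    _ ≤ _ := by
        rw [lintegral_add_right _ measurable_const, lintegral_const, measure_univ, mul_one]
        gcongr
        exact lintegral_indicator_dnoise_le hL ht hβ ha 0 x hV hF (by positivity)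

end ThinFilm

end

/-! ### Conclusion: choice of the constants -/

open ThinFilm in
theorem mainTheorem4 {Ω : Type*} [MeasurableSpace Ω] (P : Measure Ω) [IsProbabilityMeasure P]
    (L T σ θ : ℝ) (hL : 0 < L) (hT : 0 < T) (hσ : 0 < σ) (hθ : θ = 1 ∨ θ = -1)
    (β : Mode → ℝ≥0 → Ω → ℝ) (hβ : IsCylindricalWiener β P)
    (α : ℝ → Mode → ℝ) (hα : IsRegularization α)
    (u₀ : Mode → ℝ) (hu₀ : MemSobolev L 1 u₀)
    (u : ℝ → ℝ → Ω → Mode → ℝ)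
    (hu : ∀ ε > 0, IsMildSolution P L T σ θ β (α ε) u₀ (u ε)) :
    ∃ U : ℝ → ℝ → Ω → Plane → ℝ,
      (∀ ε > 0, ∀ t ∈ Ioc 0 T, ∀ᵐ ω ∂P, IsC1Version L (u ε t ω) (U ε t ω)) ∧
      ∀ p : ℝ, 1 < p → ∀ t ∈ Ioc 0 T,
        Tendsto (fun ε => ⨆ x ∈ square L,
            ∫⁻ ω, ENNReal.ofReal (‖nonlin (gradient (U ε t ω) x)‖ ^ p) ∂P)
          (𝓝[>] 0) (𝓝 0) := by
  have hθ1 : |θ| ≤ 1 := by rcases hθ with rfl | rfl <;> simp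
  have hnoise (ε : ℝ) (hε : 0 < ε) (t : ℝ) (ht : t ∈ Ioc 0 T) :
      ∀ᵐ ω ∂P, ShellSummable L (noise L β (fun k => σ * α ε k) t ω) := by
    obtain ⟨δ, hδ, C, hC⟩ := hα.decay ε hε
    refine ae_shellSummable_noise hL ht.1.le hβ (C := σ * C) hδ fun k => ?_
    rw [abs_mul, abs_of_pos hσ, mul_assoc]
    exact mul_le_mul_of_nonneg_left (hC k) hσ.le
  refine ⟨fun ε t ω => series L (u ε t ω), fun ε hε t ht => ?_, fun p hp t ht => ?_⟩
  · obtain ⟨K, -, hK⟩ := exists_decomposition hL hθ1 ht hu₀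
    filter_upwards [hK P β _ _ (hu ε hε), hnoise ε hε t ht] with ω ⟨A, hA, hcA⟩ hω
    rw [hcA]
    exact ((shellSummable_of_sum_le hL hA).add hω).isC1Version_series hL
  · obtain ⟨K, hK0, hK⟩ := exists_decomposition hL hθ1 ht hu₀
    refine ENNReal.tendsto_nhds_zero.2 fun η hη => ?_
    obtain ⟨s, hs0, hsη⟩ := ENNReal.lt_iff_exists_nnreal_btwn.1 hη
    have hs : (0 : ℝ) < s := by exact_mod_cast hs0
    -- Both error terms are to be at most `s/2`: this `r` gives `r⁻¹ ≤ s/2`, and the variance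
    -- `(4R/s)²` requested below gives `2R/√V = s/2`.
    set r : ℝ := 1 + 2 / s with hr
    set R : ℝ := 2 / L * K + r with hR
    have hr1 : 1 ≤ r := le_add_of_nonneg_right (by positivity)
    have hR0 : 0 < R := by positivity
    -- The finite set `F` is fixed before `ε` and serves every `x`. For small `ε` all `α_k^{(ε)}`
    -- with `k ∈ F` exceed `1/2`, whence the lower bound `σ/2` for the noise coefficients.
    obtain ⟨F, hF⟩ := exists_shellVar_ge (b := σ / 2) hL ht.1 (by positivity) ((4 * R / s) ^ 2)
    have hev : ∀ᶠ ε in 𝓝[>] (0 : ℝ), ∀ k ∈ F, (1 / 2 : ℝ) < α ε k :=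
      (Filter.eventually_all_finset F).2 fun k _ =>
        (hα.tendsto_one k).eventually (lt_mem_nhds (by norm_num))
    filter_upwards [hev, self_mem_nhdsWithin] with ε hε hε0
    refine iSup₂_le fun x _ => ?_
    have hvar := hF (fun k => σ * α ε k) (fun k hk => by
      rw [abs_mul, abs_of_pos hσ]
      have := (hε k hk).le.trans (le_abs_self (α ε k))
      nlinarith) x
    refine (lintegral_nonlin_gradient_le hL ht.1.le hβ (hnoise ε hε0 t ht) hK0
      (hK P β _ _ (hu ε hε0)) x (by positivity) hvar hr1 hp).trans (le_trans ?_ hsη.le)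
    rw [← ENNReal.ofReal_add (by positivity) (by positivity), ← ENNReal.ofReal_coe_nnreal]
    refine ENNReal.ofReal_le_ofReal ?_
    rw [Real.sqrt_sq (by positivity)]
    have h1 : 2 * R / (4 * R / s) = s / 2 := by
      field_simp
      norm_num
    have h2 : r⁻¹ ≤ s / 2 := by
      rw [inv_le_comm₀ (by positivity) (by positivity), inv_div]
      linarith
    rw [h1]
    linarith
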